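/- Let $\mathbb F$ be a field and let $A$ be an associative $\mathbb F$-algebra with identity $1_A$ that is a locally matrix algebra: every finite subset of $A$ lies in a subalgebra isomorphic to $M_n(\mathbb F)$ for some $n\ge 1$. For $a\in A$ choose a subalgebra $A'\subseteq A$ with $1_A,a\in A'$ and $A'\cong M_n(\mathbb F)$; the normalized rank of $a$ is $\overline r(a)=r(a)/n$, where $r(a)$ is the rank of $a$ as an $n\times n$ matrix (this does not depend on the choice of $A'$). A linear map $\varphi:A\to A$ preserves the normalized rank if $\overline r(\varphi(a))=\overline r(a)$ for all $a\in A$. A linear map $\psi:A\to A$ is a homomorphism if $\psi(ab)=\psi(a)\psi(b)$, and an antihomomorphism if $\psi(ab)=\psi(b)\psi(a)$, for all $a,b\in A$. Let $D(A)$ be the set of all $n\ge1$ such that some subalgebra of $A$ containing $1_A$ is isomorphic to $M_n(\mathbb F)$. The Steinitz number of $A$ is the formal least common multiple $\mathbf{st}(A)=\prod_p p^{k_p}$ of $D(A)$, where $k_p\in\{0,1,2,\dots,\infty\}$ is the supremum over $n\in D(A)$ of the exponent of the prime $p$ in $n$. It is locally finite if $k_p<\infty$ for every prime $p$. (1) Suppose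 that $\operatorname{char}\mathbb F\ne2$ and that $\mathbf{st}(A)$ is locally finite. Then every linear map $\varphi:A\to A$ that preserves the normalized rank and satisfies $\varphi(1_A)=1_A$ is a homomorphism or an antihomomorphism. More generally, for every linear map $\varphi:A\to A$ that preserves the normalized rank there are invertible elements $X,Y\in A$ and a linear map $\psi:A\to A$ with $\psi(1_A)=1_A$, which is a homomorphism or an antihomomorphism, such that $\varphi(a)=X\psi(a)Y$ for all $a\in A$. (2) If $\mathbf{st}(A)$ is not locally finite and $\dim_{\mathbb F}A=\aleph_0$, then there is a linear map $\varphi:A\to A$ that preserves the normalized rank, satisfies $\varphi(1_A)=1_A$, and is neither a homomorphism nor an antihomomorphism; moreover, $\varphi$ is not of the form $a\mapsto X\psi(a)Y$ with $X,Y\in A$ invertible and $\psi:A\to A$ a homomorphism or an antihomomorphism. -/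

import Mathlib

/-- The unital subalgebra `S` of `A` is isomorphic to the algebra of `n × n` matrices over `F`,
where `n ≥ 1`. -/
def IsMatrixSubalgebra (F : Type*) {A : Type*} [Field F] [Ring A] [Algebra F A]
    (S : Subalgebra F A) (n : ℕ) : Prop :=
  0 < n ∧ Nonempty (S ≃ₐ[F] Matrix (Fin n) (Fin n) F)

/-- The unital `F`-algebra `A` is a locally matrix algebra: every finite subset is contained in a
subalgebra isomorphic to some `M_n(F)`. Since `1` can be added to the finite subset, and is then
the identity element of the subalgebra, subalgebras containing `1` suffice. -/
def IsLocallyMatrixAlgebra (F A : Type*) [Field F] [Ring A] [Algebra F A] : Prop :=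
  ∀ s : Finset A, ∃ (S : Subalgebra F A) (n : ℕ), IsMatrixSubalgebra F S n ∧ (s : Set A) ⊆ S

/-- `q` is the value `r(a) / n` computed in some subalgebra `S` with `1, a ∈ S` and
`S ≅ M_n(F)`, `n ≥ 1`. -/
def IsNormalizedRankValue (F : Type*) {A : Type*} [Field F] [Ring A] [Algebra F A]
    (a : A) (q : ℚ) : Prop :=
  ∃ (n : ℕ) (S : Subalgebra F A) (e : S ≃ₐ[F] Matrix (Fin n) (Fin n) F) (ha : a ∈ S),
    0 < n ∧ q = ((e ⟨a, ha⟩).rank : ℚ) / (n : ℚ)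

open Classical in
/-- The normalized rank `r(a) / n` of an element `a`, computed in a chosen subalgebra isomorphic to
`M_n(F)` that contains `1` and `a`. In a locally matrix algebra such a subalgebra exists. -/
noncomputable def normalizedRank (F : Type*) {A : Type*} [Field F] [Ring A] [Algebra F A]
    (a : A) : ℚ :=
  if h : ∃ q : ℚ, IsNormalizedRankValue F a q then h.choose else 0

/-- A linear map that preserves the normalized rank. -/
def PreservesNormalizedRank {F A B : Type*} [Field F] [Ring A] [Algebra F A] [Ring B] [Algebra F B]
    (φ : A →ₗ[F] B) : Prop :=
  ∀ a : A, normalizedRank F (φ a) = normalizedRank F a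

/-- The linear map `φ` is a homomorphism of associative algebras. -/
def IsAlgHomomorphism {F A B : Type*} [Field F] [Ring A] [Algebra F A] [Ring B] [Algebra F B]
    (φ : A →ₗ[F] B) : Prop :=
  ∀ a b : A, φ (a * b) = φ a * φ b

/-- The linear map `φ` is an antihomomorphism of associative algebras. -/
def IsAlgAntihomomorphism {F A B : Type*} [Field F] [Ring A] [Algebra F A] [Ring B] [Algebra F B]
    (φ : A →ₗ[F] B) : Prop :=
  ∀ a b : A, φ (a * b) = φ b * φ a

/-- A Steinitz number `∏ p ^ (k_p)`, given by its exponents `k_p ∈ {0, 1, 2, …, ∞}`. -/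
abbrev SteinitzNumber : Type := Nat.Primes → ℕ∞

/-- All exponents of the Steinitz number are finite. -/
def SteinitzNumber.IsLocallyFinite (s : SteinitzNumber) : Prop :=
  ∀ p : Nat.Primes, s p ≠ ⊤

/-- The set `D(A)` of all `n ≥ 1` such that some subalgebra of `A` containing `1` is isomorphic to
`M_n(F)`. -/
def matrixDegrees (F A : Type*) [Field F] [Ring A] [Algebra F A] : Set ℕ :=
  {n : ℕ | ∃ S : Subalgebra F A, IsMatrixSubalgebra F S n}

/-- The Steinitz number `st(A)`, the least common multiple of `D(A)`: the exponent of `p` is the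
supremum of the exponents of `p` in the elements of `D(A)`. -/
noncomputable def steinitzNumber (F A : Type*) [Field F] [Ring A] [Algebra F A] : SteinitzNumber :=
  fun p => ⨆ n ∈ matrixDegrees F A, ((padicValNat (p : ℕ) n : ℕ) : ℕ∞)

/-! Suppose first that `φ` is unital and preserves the normalized rank. For an idempotent `a`, the
ranks of `a` and `1 - a` add up to 1, and so do those of `φ a` and `1 - φ a`; this forces `φ a` to
be idempotent (`PreservesNormalizedRank.map_mul_self`). Expanding `φ a * φ a = φ a` for a few small
idempotents built from matrix units gives the Jordan relations between the images `x i j` of the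
units (`isJordanUnits_map`), where characteristic different from 2 is used. For size at least 2, `x`
splits into a system of matrix units `h` and a transposed one `x - h`, and `P = ∑ h k k` is an
idempotent that cuts `φ` into a homomorphism and an antihomomorphism
(`PreservesNormalizedRank.exists_isJordanSplit`).

This `P` does not change when the matrix subalgebra grows (`IsJordanSplit.unique`). Hence its rank
is `m` times a normalized rank for every larger size `m`. If the Steinitz number is locally finite,
`m` can absorb all powers of any given prime, so the rank of `P` has denominator 1 and is 0 or 1.
Then `P` is 0 or 1, and one of the two summands of `φ` disappears. Without `φ 1 = 1`, the element `φ
1` is still invertible and can be divided out.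

Conversely, if a prime `p` has infinite exponent, there is an idempotent `P` of rank `1 / p`, and
both of its corners have room for matrix units of all required sizes. A map that is a homomorphism
into one corner and an antihomomorphism into the other therefore extends from each matrix subalgebra
to any larger one (`IsJordanSplit.extend`), and countable dimension allows the extensions to be
glued along a chain. Such a map preserves rank in every characteristic, because it carries
equivalent elements to equivalent elements and matrix units to matrix units
(`IsJordanSplit.preservesNormalizedRank`). -/

/-! ### Ranks of matrices -/

open Module in
/-- The rank is additive on orthogonal idempotent matrices. -/
theorem rank_add_of_orthogonal {F n : Type*} [Field F] [Fintype n]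
    {P Q : Matrix n n F} (hP : P * P = P) (hQ : Q * Q = Q) (hPQ : P * Q = 0) (hQP : Q * P = 0) :
    (P + Q).rank = P.rank + Q.rank := by
  have hsup : LinearMap.range (P + Q).mulVecLin =
      LinearMap.range P.mulVecLin ⊔ LinearMap.range Q.mulVecLin := by
    apply le_antisymm
    · rintro _ ⟨x, rfl⟩
      simp only [Matrix.mulVecLin_apply, Matrix.add_mulVec]
      exact Submodule.add_mem_sup ⟨x, rfl⟩ ⟨x, rfl⟩
    · refine sup_le ?_ ?_
      · rintro _ ⟨x, rfl⟩
        refine ⟨P.mulVec x, ?_⟩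
        simp [Matrix.mulVec_mulVec, hP, hQP]
      · rintro _ ⟨x, rfl⟩
        refine ⟨Q.mulVec x, ?_⟩
        simp [Matrix.mulVec_mulVec, hQ, hPQ]
  have hinf : LinearMap.range P.mulVecLin ⊓ LinearMap.range Q.mulVecLin = ⊥ := by
    rw [eq_bot_iff]
    rintro _ ⟨⟨x, rfl⟩, ⟨y, hy⟩⟩
    have h : P.mulVec (Q.mulVec y) = P.mulVec (P.mulVec x) := congrArg P.mulVec hy
    rw [Matrix.mulVec_mulVec, Matrix.mulVec_mulVec, hP, hPQ] at h
    simpa using h.symm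
  have h := Submodule.finrank_sup_add_finrank_inf_eq
    (LinearMap.range P.mulVecLin) (LinearMap.range Q.mulVecLin)
  rw [hinf, finrank_bot, add_zero, ← hsup] at h
  exact h

theorem rank_sum_of_orthogonal {F n ι : Type*} [Field F] [Fintype n]
    {p : ι → Matrix n n F} (hp : ∀ i, p i * p i = p i) (ho : ∀ i j, i ≠ j → p i * p j = 0)
    (s : Finset ι) : (∑ i ∈ s, p i).rank = ∑ i ∈ s, (p i).rank := by
  classical
  induction s using Finset.induction_on with
  | empty => simp
  | insert a s ha ih =>
    have key : ∀ t ⊆ s, (∑ i ∈ t, p i) * (∑ i ∈ s, p i) = ∑ i ∈ t, p i := by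
      intro t ht
      rw [Finset.sum_mul]
      refine Finset.sum_congr rfl fun i hi => ?_
      rw [Finset.mul_sum, Finset.sum_eq_single i (fun j _ hj => ho i j hj.symm)
        (fun h => absurd (ht hi) h), hp]
    rw [Finset.sum_insert ha, Finset.sum_insert ha, rank_add_of_orthogonal (hp a)
      (key s subset_rfl) ?_ ?_, ih]
    · rw [Finset.mul_sum]
      exact Finset.sum_eq_zero fun j hj => ho a j (by rintro rfl; exact ha hj)
    · rw [Finset.sum_mul]
      exact Finset.sum_eq_zero fun j hj => ho j a (by rintro rfl; exact ha hj)

open Module in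
/-- Two matrices that sum to the identity and whose ranks do not exceed the size in total are
idempotent. -/
theorem mul_self_of_rank_add_le {F n : Type*} [Field F] [Fintype n] [DecidableEq n]
    {P Q : Matrix n n F} (h1 : P + Q = 1) (hr : P.rank + Q.rank ≤ Fintype.card n) :
    P * P = P := by
  have hsup : LinearMap.range P.mulVecLin ⊔ LinearMap.range Q.mulVecLin = ⊤ := by
    rw [eq_top_iff]
    intro x _
    have : x = P.mulVec x + Q.mulVec x := by
      rw [← Matrix.add_mulVec, h1, Matrix.one_mulVec]
    rw [this]
    exact Submodule.add_mem_sup ⟨x, rfl⟩ ⟨x, rfl⟩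
  have hinf : LinearMap.range P.mulVecLin ⊓ LinearMap.range Q.mulVecLin = ⊥ := by
    have h := Submodule.finrank_sup_add_finrank_inf_eq
      (LinearMap.range P.mulVecLin) (LinearMap.range Q.mulVecLin)
    rw [hsup, finrank_top, finrank_fintype_fun_eq_card] at h
    apply Submodule.finrank_eq_zero.1
    change _ = P.rank + Q.rank at h
    omega
  have hQ : Q = 1 - P := by rw [← h1]; abel
  have hPQ : P * Q = 0 := by
    apply Matrix.toLin'.injective
    refine LinearMap.ext fun x => ?_
    -- Since `Q = 1 - P` commutes with `P`, the values of `P * Q` lie in both ranges.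
    have hx : (P * Q).mulVec x ∈ LinearMap.range P.mulVecLin ⊓ LinearMap.range Q.mulVecLin := by
      refine ⟨⟨Q.mulVec x, by simp [Matrix.mulVec_mulVec]⟩, ⟨P.mulVec x, ?_⟩⟩
      simp only [Matrix.mulVecLin_apply, Matrix.mulVec_mulVec, hQ, mul_sub, sub_mul, mul_one,
        one_mul]
    rw [hinf] at hx
    simpa using hx
  rw [hQ, mul_sub, mul_one, sub_eq_zero] at hPQ
  exact hPQ.symm

/-- Every square matrix is equivalent to a diagonal idempotent. -/
theorem exists_units_mul_eq_sum_single {F n : Type*} [Field F] [Fintype n] [DecidableEq n]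
    (M : Matrix n n F) :
    ∃ (V U : (Matrix n n F)ˣ) (s : Finset n), s.card = M.rank ∧
      M = (V : Matrix n n F) * (∑ i ∈ s, Matrix.single i i 1) * (U : Matrix n n F) := by
  classical
  obtain ⟨V, U, e, hV, hU, h⟩ := M.exists_rank_normal_form
  obtain ⟨V, rfl⟩ := hV
  obtain ⟨U, rfl⟩ := hU
  refine ⟨V⁻¹, U⁻¹, Finset.univ.map (Function.Embedding.inl.trans e.symm.toEmbedding), by simp, ?_⟩
  have : (Matrix.fromBlocks 1 0 0 0 :
      Matrix (Fin M.rank ⊕ Fin (Fintype.card n - M.rank)) _ F).submatrix e e =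
      ∑ i ∈ Finset.univ.map (Function.Embedding.inl.trans e.symm.toEmbedding),
        Matrix.single i i 1 := by
    ext a b
    obtain ⟨a, rfl⟩ := e.symm.surjective a
    obtain ⟨b, rfl⟩ := e.symm.surjective b
    rcases a with a | a <;> rcases b with b | b <;>
      simp [Matrix.sum_apply, Matrix.single_apply, Matrix.one_apply, ite_and]
  rw [← this, ← h]
  simp [mul_assoc]

theorem rank_units_mul_mul {F n : Type*} [Field F] [Fintype n] [DecidableEq n]
    (V U : (Matrix n n F)ˣ) (M : Matrix n n F) :
    ((V : Matrix n n F) * M * U).rank = M.rank := by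
  rw [Matrix.rank_mul_eq_left_of_isUnit_det, Matrix.rank_mul_eq_right_of_isUnit_det]
  · exact (Matrix.isUnit_iff_isUnit_det _).1 V.isUnit
  · exact (Matrix.isUnit_iff_isUnit_det _).1 U.isUnit

theorem isUnit_of_rank_eq_card {F n : Type*} [Field F] [Fintype n] [DecidableEq n]
    {M : Matrix n n F} (h : M.rank = Fintype.card n) : IsUnit M := by
  obtain ⟨V, U, s, hs, rfl⟩ := exists_units_mul_eq_sum_single M
  have : s = Finset.univ := by rw [← Finset.card_eq_iff_eq_univ, hs, h]
  have h1 : ∑ i ∈ s, Matrix.single i i (1 : F) = (1 : Matrix n n F) := by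
    rw [this]; ext a b; simp [Matrix.sum_apply, Matrix.single_apply, Matrix.one_apply, ite_and]
  rw [h1, mul_one]
  exact (V * U).isUnit

theorem eq_zero_of_rank_eq_zero {F n : Type*} [Field F] [Fintype n] [DecidableEq n]
    {M : Matrix n n F} (h : M.rank = 0) : M = 0 := by
  obtain ⟨V, U, s, hs, rfl⟩ := exists_units_mul_eq_sum_single M
  rw [h, Finset.card_eq_zero] at hs
  simp [hs]

theorem rank_le_of_mul_mul_eq {F n : Type*} [Field F] [Fintype n]
    {P Q R S : Matrix n n F} (h : P = R * Q * S) : P.rank ≤ Q.rank := by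
  rw [h]
  exact (Matrix.rank_mul_le_left _ _).trans (Matrix.rank_mul_le_right _ _)

/-- A unital homomorphism between matrix algebras scales the rank by the quotient of the sizes. -/
theorem rank_algHom {F m n : Type*} [Field F] [Fintype n] [DecidableEq n] [Fintype m]
    [DecidableEq m] (f : Matrix n n F →ₐ[F] Matrix m m F) (a : Matrix n n F) :
    (f a).rank * Fintype.card n = a.rank * Fintype.card m := by
  rcases isEmpty_or_nonempty n with hn | ⟨⟨i₀⟩⟩
  · have : a.rank = 0 := by simpa using a.rank_le_card_width
    simp [this]
  set p : n → Matrix m m F := fun i => f (Matrix.single i i 1) with hp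
  have hpp : ∀ i, p i * p i = p i := fun i => by simp [hp, ← map_mul]
  have hpo : ∀ i j, i ≠ j → p i * p j = 0 := fun i j hij => by
    simp [hp, ← map_mul, Matrix.single_mul_single_of_ne, hij]
  -- The images of the diagonal units are linked by those of the off-diagonal ones, so they share
  -- one rank; as they sum to 1, it is the quotient of the sizes.
  have hle : ∀ i j, (p i).rank ≤ (p j).rank := fun i j =>
    rank_le_of_mul_mul_eq (R := f (Matrix.single i j 1)) (S := f (Matrix.single j i 1))
      (by simp [hp, ← map_mul])
  have heq : ∀ i, (p i).rank = (p i₀).rank := fun i => le_antisymm (hle _ _) (hle _ _)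
  have h1 : ∑ i, p i = 1 := by
    rw [hp, ← map_sum, ← map_one f]
    congr 1
    ext a b; simp [Matrix.sum_apply, Matrix.single_apply, Matrix.one_apply, ite_and]
  have hc : Fintype.card n * (p i₀).rank = Fintype.card m := by
    rw [← Matrix.rank_one (R := F) (n := m), ← h1, rank_sum_of_orthogonal hpp hpo]
    simp [heq]
  obtain ⟨V, U, s, hs, rfl⟩ := exists_units_mul_eq_sum_single a
  rw [← hs, map_mul, map_mul, map_sum]
  have := rank_units_mul_mul (V.map (f : Matrix n n F →* Matrix m m F))
    (U.map (f : Matrix n n F →* Matrix m m F)) (∑ i ∈ s, p i)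
  simp only [Units.coe_map, MonoidHom.coe_coe] at this
  rw [this, rank_sum_of_orthogonal hpp hpo, ← hc]
  simp [heq]
  ring

/-! ### The normalized rank in a locally matrix algebra -/

section NormalizedRank

variable {F A : Type*} [Field F] [Ring A] [Algebra F A]

theorem IsLocallyMatrixAlgebra.exists_subalgebra_of_finite (hA : IsLocallyMatrixAlgebra F A)
    {s : Set A} (hs : s.Finite) :
    ∃ (S : Subalgebra F A) (n : ℕ) (_ : S ≃ₐ[F] Matrix (Fin n) (Fin n) F), 0 < n ∧ s ⊆ S := by
  obtain ⟨S, n, ⟨hn, ⟨e⟩⟩, h⟩ := hA hs.toFinset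
  exact ⟨S, n, e, hn, by simpa using h⟩

theorem IsLocallyMatrixAlgebra.exists_subalgebra_ge (hA : IsLocallyMatrixAlgebra F A)
    {s : Set A} (hs : s.Finite) (S T : Subalgebra F A) [FiniteDimensional F S]
    [FiniteDimensional F T] :
    ∃ (U : Subalgebra F A) (n : ℕ) (_ : U ≃ₐ[F] Matrix (Fin n) (Fin n) F), 0 < n ∧ s ⊆ U ∧
      S ≤ U ∧ T ≤ U := by
  obtain ⟨s₁, h₁⟩ := (show (Subalgebra.toSubmodule S).FG from
    Module.Finite.iff_fg.1 ‹FiniteDimensional F S›)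
  obtain ⟨s₂, h₂⟩ := (show (Subalgebra.toSubmodule T).FG from
    Module.Finite.iff_fg.1 ‹FiniteDimensional F T›)
  obtain ⟨U, n, e, hn, h⟩ := hA.exists_subalgebra_of_finite
    ((hs.union s₁.finite_toSet).union s₂.finite_toSet)
  simp only [Set.union_subset_iff] at h
  refine ⟨U, n, e, hn, h.1.1, ?_, ?_⟩
  · change Subalgebra.toSubmodule S ≤ Subalgebra.toSubmodule U
    refine le_trans (le_of_eq h₁.symm) (Submodule.span_le.2 h.1.2)
  · change Subalgebra.toSubmodule T ≤ Subalgebra.toSubmodule U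
    refine le_trans (le_of_eq h₂.symm) (Submodule.span_le.2 h.2)

theorem finiteDimensional_of_equiv_matrix {S : Subalgebra F A} {n : ℕ}
    (e : S ≃ₐ[F] Matrix (Fin n) (Fin n) F) : FiniteDimensional F S :=
  Module.Finite.equiv e.symm.toLinearEquiv

theorem rank_mul_eq_of_le {S T : Subalgebra F A} {n m : ℕ}
    (e : S ≃ₐ[F] Matrix (Fin n) (Fin n) F) (f : T ≃ₐ[F] Matrix (Fin m) (Fin m) F) (h : S ≤ T)
    {a : A} (ha : a ∈ S) : (f ⟨a, h ha⟩).rank * n = (e ⟨a, ha⟩).rank * m := by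
  have := rank_algHom ((f : T →ₐ[F] Matrix (Fin m) (Fin m) F).comp
    ((Subalgebra.inclusion h).comp (e.symm : Matrix (Fin n) (Fin n) F →ₐ[F] S))) (e ⟨a, ha⟩)
  simpa using this

/-- A diagonal matrix unit has rank 1 in `S`, so its rank in `T` is `m / n`, which must be an
integer. -/
theorem dvd_of_le {S T : Subalgebra F A} {n m : ℕ}
    (e : S ≃ₐ[F] Matrix (Fin n) (Fin n) F) (f : T ≃ₐ[F] Matrix (Fin m) (Fin m) F)
    (hn : 0 < n) (h : S ≤ T) : n ∣ m := by
  have := rank_mul_eq_of_le e f h (e.symm (Matrix.single ⟨0, hn⟩ ⟨0, hn⟩ 1)).2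
  have h2 : (Matrix.single ⟨0, hn⟩ ⟨0, hn⟩ (1 : F) : Matrix (Fin n) (Fin n) F).rank = 1 := by
    classical
    rw [← Matrix.diagonal_single, Matrix.rank_diagonal]
    simp [Pi.single_apply]
  simp only [Subtype.coe_eta, AlgEquiv.apply_symm_apply, h2, one_mul] at this
  exact ⟨_, by rw [← this, mul_comm]⟩

/-- Both subalgebras lie in a common matrix subalgebra, and passing to it multiplies rank and size
by the same factor. -/
theorem IsLocallyMatrixAlgebra.isNormalizedRankValue_unique (hA : IsLocallyMatrixAlgebra F A)
    {a : A} {q r : ℚ} (hq : IsNormalizedRankValue F a q) (hr : IsNormalizedRankValue F a r) :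
    q = r := by
  obtain ⟨n, S, e, ha, hn, rfl⟩ := hq
  obtain ⟨m, T, f, hb, hm, rfl⟩ := hr
  have := finiteDimensional_of_equiv_matrix e
  have := finiteDimensional_of_equiv_matrix f
  obtain ⟨U, k, g, hk, -, hS, hT⟩ := hA.exists_subalgebra_ge Set.finite_empty S T
  have h1 := rank_mul_eq_of_le e g hS ha
  have h2 := rank_mul_eq_of_le f g hT hb
  have h3 : ((g ⟨a, hS ha⟩).rank : ℚ) * n = (e ⟨a, ha⟩).rank * k := by exact_mod_cast h1
  have h4 : ((g ⟨a, hS ha⟩).rank : ℚ) * m = (f ⟨a, hb⟩).rank * k := by exact_mod_cast h2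
  have hn' : (n : ℚ) ≠ 0 := by positivity
  have hm' : (m : ℚ) ≠ 0 := by positivity
  have hk' : (k : ℚ) ≠ 0 := by positivity
  rw [div_eq_div_iff hn' hm']
  apply mul_right_cancel₀ hk'
  linear_combination (-(m : ℚ)) * h3 + (n : ℚ) * h4

theorem IsLocallyMatrixAlgebra.normalizedRank_eq (hA : IsLocallyMatrixAlgebra F A)
    {S : Subalgebra F A} {n : ℕ} (e : S ≃ₐ[F] Matrix (Fin n) (Fin n) F) (hn : 0 < n) {a : A}
    (ha : a ∈ S) : normalizedRank F a = ((e ⟨a, ha⟩).rank : ℚ) / n := by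
  have h : ∃ q : ℚ, IsNormalizedRankValue F a q := ⟨_, n, S, e, ha, hn, rfl⟩
  rw [normalizedRank, dif_pos h]
  exact hA.isNormalizedRankValue_unique h.choose_spec ⟨n, S, e, ha, hn, rfl⟩

namespace IsLocallyMatrixAlgebra

variable (hA : IsLocallyMatrixAlgebra F A)
include hA

theorem nontrivial : Nontrivial A := by
  obtain ⟨S, n, e, hn, -⟩ := hA.exists_subalgebra_of_finite Set.finite_empty
  have : Nonempty (Fin n) := ⟨⟨0, hn⟩⟩
  have : Nontrivial S := e.toEquiv.nontrivial
  exact Subtype.val_injective.nontrivial (α := S)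

theorem normalizedRank_one : normalizedRank F (1 : A) = 1 := by
  obtain ⟨S, n, e, hn, -⟩ := hA.exists_subalgebra_of_finite Set.finite_empty
  rw [hA.normalizedRank_eq e hn S.one_mem]
  have : (⟨1, S.one_mem⟩ : S) = 1 := rfl
  rw [this, map_one, Matrix.rank_one, Fintype.card_fin]
  field_simp

theorem normalizedRank_nonneg (a : A) : 0 ≤ normalizedRank F a := by
  obtain ⟨S, n, e, hn, h⟩ := hA.exists_subalgebra_of_finite (Set.finite_singleton a)
  rw [hA.normalizedRank_eq e hn (h rfl)]
  positivity

theorem normalizedRank_le_one (a : A) : normalizedRank F a ≤ 1 := by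
  obtain ⟨S, n, e, hn, h⟩ := hA.exists_subalgebra_of_finite (Set.finite_singleton a)
  rw [hA.normalizedRank_eq e hn (h rfl), div_le_one (by positivity)]
  exact_mod_cast Matrix.rank_le_width _

theorem normalizedRank_zero : normalizedRank F (0 : A) = 0 := by
  obtain ⟨S, n, e, hn, -⟩ := hA.exists_subalgebra_of_finite Set.finite_empty
  rw [hA.normalizedRank_eq e hn S.zero_mem]
  have : (⟨0, S.zero_mem⟩ : S) = 0 := rfl
  rw [this, map_zero, Matrix.rank_zero]
  simp

theorem eq_zero_of_normalizedRank {a : A} (h : normalizedRank F a = 0) : a = 0 := by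
  obtain ⟨S, n, e, hn, hs⟩ := hA.exists_subalgebra_of_finite (Set.finite_singleton a)
  have hn' : (n : ℚ) ≠ 0 := by positivity
  rw [hA.normalizedRank_eq e hn (hs rfl), div_eq_zero_iff, or_iff_left hn', Nat.cast_eq_zero] at h
  have := eq_zero_of_rank_eq_zero h
  rw [EmbeddingLike.map_eq_zero_iff] at this
  exact congrArg Subtype.val this

theorem isUnit_of_normalizedRank {a : A} (h : normalizedRank F a = 1) : IsUnit a := by
  obtain ⟨S, n, e, hn, hs⟩ := hA.exists_subalgebra_of_finite (Set.finite_singleton a)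
  have hn' : (n : ℚ) ≠ 0 := by positivity
  rw [hA.normalizedRank_eq e hn (hs rfl), div_eq_one_iff_eq hn', Nat.cast_inj] at h
  have := isUnit_of_rank_eq_card (h.trans (Fintype.card_fin n).symm)
  rw [MulEquiv.isUnit_map e] at this
  exact this.map S.val

theorem normalizedRank_mul_mul_le (a b c : A) :
    normalizedRank F (a * b * c) ≤ normalizedRank F b := by
  obtain ⟨S, n, e, hn, hs⟩ := hA.exists_subalgebra_of_finite
    (Set.toFinite {a, b, c})
  have ha : a ∈ S := hs (by simp)
  have hb : b ∈ S := hs (by simp)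
  have hc : c ∈ S := hs (by simp)
  rw [hA.normalizedRank_eq e hn hb, hA.normalizedRank_eq e hn (mul_mem (mul_mem ha hb) hc)]
  gcongr
  exact rank_le_of_mul_mul_eq (R := e ⟨a, ha⟩) (S := e ⟨c, hc⟩) (by rw [← map_mul, ← map_mul]; rfl)

theorem normalizedRank_units_mul_mul (u v : Aˣ) (a : A) :
    normalizedRank F (u * a * v) = normalizedRank F a := by
  refine le_antisymm (hA.normalizedRank_mul_mul_le _ _ _) ?_
  have := hA.normalizedRank_mul_mul_le (↑u⁻¹) (u * a * v) (↑v⁻¹)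
  simpa [mul_assoc] using this

theorem normalizedRank_add {p q : A} (hp : p * p = p) (hq : q * q = q) (hpq : p * q = 0)
    (hqp : q * p = 0) : normalizedRank F (p + q) = normalizedRank F p + normalizedRank F q := by
  obtain ⟨S, n, e, hn, hs⟩ := hA.exists_subalgebra_of_finite (Set.toFinite {p, q})
  have ha : p ∈ S := hs (by simp)
  have hb : q ∈ S := hs (by simp)
  rw [hA.normalizedRank_eq e hn ha, hA.normalizedRank_eq e hn hb,
    hA.normalizedRank_eq e hn (add_mem ha hb), ← add_div]
  have h : e ⟨p + q, add_mem ha hb⟩ = e ⟨p, ha⟩ + e ⟨q, hb⟩ := by rw [← map_add]; rfl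
  rw [h, rank_add_of_orthogonal]
  · push_cast; rfl
  · rw [← map_mul]; exact congrArg e (Subtype.ext hp)
  · rw [← map_mul]; exact congrArg e (Subtype.ext hq)
  · rw [← map_mul, ← map_zero e]; exact congrArg e (Subtype.ext hpq)
  · rw [← map_mul, ← map_zero e]; exact congrArg e (Subtype.ext hqp)

theorem mul_self_of_normalizedRank {p q : A} (h1 : p + q = 1)
    (h : normalizedRank F p + normalizedRank F q = 1) : p * p = p := by
  obtain ⟨S, n, e, hn, hs⟩ := hA.exists_subalgebra_of_finite (Set.toFinite {p, q})
  have ha : p ∈ S := hs (by simp)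
  have hb : q ∈ S := hs (by simp)
  have hn' : (n : ℚ) ≠ 0 := by positivity
  rw [hA.normalizedRank_eq e hn ha, hA.normalizedRank_eq e hn hb, ← add_div,
    div_eq_one_iff_eq hn'] at h
  have h2 : e ⟨p, ha⟩ + e ⟨q, hb⟩ = 1 := by
    rw [← map_add, ← map_one e]; exact congrArg e (Subtype.ext h1)
  have h3 := mul_self_of_rank_add_le h2 (by rw [Fintype.card_fin]; exact_mod_cast h.le)
  rw [← map_mul] at h3
  exact congrArg Subtype.val (e.injective h3)

theorem normalizedRank_sum {ι : Type*} {p : ι → A} (hp : ∀ i, p i * p i = p i)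
    (ho : ∀ i j, i ≠ j → p i * p j = 0) (s : Finset ι) :
    normalizedRank F (∑ i ∈ s, p i) = ∑ i ∈ s, normalizedRank F (p i) := by
  classical
  induction s using Finset.induction_on with
  | empty => simp [hA.normalizedRank_zero]
  | insert a s ha ih =>
    have key : ∀ t ⊆ s, (∑ i ∈ t, p i) * (∑ i ∈ s, p i) = ∑ i ∈ t, p i := by
      intro t ht
      rw [Finset.sum_mul]
      refine Finset.sum_congr rfl fun i hi => ?_
      rw [Finset.mul_sum, Finset.sum_eq_single i (fun j _ hj => ho i j hj.symm)
        (fun h => absurd (ht hi) h), hp]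
    rw [Finset.sum_insert ha, Finset.sum_insert ha, hA.normalizedRank_add (hp a)
      (key s subset_rfl) ?_ ?_, ih]
    · rw [Finset.mul_sum]
      exact Finset.sum_eq_zero fun j hj => ho a j (by rintro rfl; exact ha hj)
    · rw [Finset.sum_mul]
      exact Finset.sum_eq_zero fun j hj => ho j a (by rintro rfl; exact ha hj)

end IsLocallyMatrixAlgebra

end NormalizedRank

/-! ### Systems of matrix units -/

/-- The family `e` multiplies like the standard matrix units. -/
def IsMatrixUnits {ι A : Type*} [DecidableEq ι] [Mul A] [Zero A] (e : ι → ι → A) : Prop :=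
  ∀ i j k l, e i j * e k l = if j = k then e i l else 0

namespace IsMatrixUnits

section

variable {ι κ F A : Type*} [DecidableEq ι] [DecidableEq κ] [Field F] [Ring A] [Algebra F A]
  {e : ι → ι → A} (he : IsMatrixUnits e)
include he

theorem mul_same (i j l : ι) : e i j * e j l = e i l := by rw [he, if_pos rfl]

theorem mul_of_ne {j k : ι} (h : j ≠ k) (i l : ι) : e i j * e k l = 0 := by rw [he, if_neg h]

theorem sum_mul [Fintype ι] (i j : ι) : (∑ k, e k k) * e i j = e i j := by
  rw [Finset.sum_mul, Finset.sum_eq_single i, he.mul_same]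
  · intro k _ hk
    exact he.mul_of_ne hk _ _
  · simp

theorem mul_sum [Fintype ι] (i j : ι) : e i j * (∑ k, e k k) = e i j := by
  rw [Finset.mul_sum, Finset.sum_eq_single j, he.mul_same]
  · intro k _ hk
    exact he.mul_of_ne hk.symm _ _
  · simp

theorem linearIndependent [Fintype ι] (h0 : ∀ i, e i i ≠ 0) :
    LinearIndependent F fun x : ι × ι => e x.1 x.2 := by
  rw [Fintype.linearIndependent_iff]
  rintro g hg ⟨i, j⟩
  -- Multiplying by `e i i` and `e j i` isolates the coefficient at `(i, j)`.
  have h : e i i * (∑ x : ι × ι, g x • e x.1 x.2) * e j i = g (i, j) • e i i := by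
    rw [Finset.mul_sum, Finset.sum_mul, Finset.sum_eq_single (i, j)]
    · rw [mul_smul_comm, smul_mul_assoc, he.mul_same, he.mul_same]
    · rintro ⟨k, l⟩ - hkl
      rw [mul_smul_comm, smul_mul_assoc]
      by_cases hk : i = k
      · subst hk
        have hl : l ≠ j := fun h => hkl (by rw [h])
        rw [mul_assoc, he.mul_of_ne hl, mul_zero, smul_zero]
      · rw [he.mul_of_ne hk, zero_mul, smul_zero]
    · simp
  rw [hg, mul_zero, zero_mul] at h
  exact (smul_eq_zero.1 h.symm).resolve_right (h0 i)

/-- Refining a system of matrix units by a system of matrix units for one of its diagonal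
elements. -/
theorem refine [Fintype κ] {i₀ : ι} {f : κ → κ → A} (hf : IsMatrixUnits f)
    (h : ∑ a, f a a = e i₀ i₀) :
    IsMatrixUnits fun x y : ι × κ => e x.1 i₀ * f x.2 y.2 * e i₀ y.1 := by
  rintro ⟨i, a⟩ ⟨j, b⟩ ⟨k, c⟩ ⟨l, d⟩
  simp only [Prod.mk.injEq]
  have h1 : e i i₀ * f a b * e i₀ j * (e k i₀ * f c d * e i₀ l) =
      e i i₀ * (f a b * (e i₀ j * e k i₀) * f c d) * e i₀ l := by
    simp only [mul_assoc]
  rw [h1, he]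
  by_cases hjk : j = k
  · rw [if_pos hjk, ← h, hf.mul_sum, hf]
    by_cases hbc : b = c
    · simp [hjk, hbc]
    · simp [hbc]
  · simp [hjk]

omit [DecidableEq κ] in
theorem refine_sum [Fintype κ] {i₀ : ι} {f : κ → κ → A}
    (h : ∑ a, f a a = e i₀ i₀) (i j : ι) :
    ∑ a, e i i₀ * f a a * e i₀ j = e i j := by
  rw [← Finset.sum_mul, ← Finset.mul_sum, h, he.mul_same, he.mul_same]

theorem normalizedRank_eq (hA : IsLocallyMatrixAlgebra F A) (i j : ι) :
    normalizedRank F (e i i) = normalizedRank F (e j j) := by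
  have key : ∀ i j, normalizedRank F (e i i) ≤ normalizedRank F (e j j) := fun i j => by
    have := hA.normalizedRank_mul_mul_le (e i j) (e j j) (e j i)
    rwa [he.mul_same, he.mul_same] at this
  exact le_antisymm (key i j) (key j i)

theorem normalizedRank_sum (hA : IsLocallyMatrixAlgebra F A) (s : Finset ι) (j : ι) :
    normalizedRank F (∑ i ∈ s, e i i) = s.card * normalizedRank F (e j j) := by
  rw [hA.normalizedRank_sum (fun i => he.mul_same i i i) (fun i j hij => he.mul_of_ne hij i j),
    Finset.sum_congr rfl fun i _ => he.normalizedRank_eq hA i j]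
  simp

end

end IsMatrixUnits

section

variable {F A : Type*} [Field F] [Ring A] [Algebra F A]

theorem isMatrixUnits_single {n : Type*} [DecidableEq n] [Fintype n] :
    IsMatrixUnits fun i j : n => (Matrix.single i j (1 : F)) := by
  intro i j k l
  by_cases h : j = k
  · subst h; simp
  · simp [h, Matrix.single_mul_single_of_ne]

theorem IsMatrixUnits.map {ι A B G : Type*} [DecidableEq ι] [Ring A] [Ring B] [FunLike G A B]
    [NonUnitalRingHomClass G A B] {e : ι → ι → A} (he : IsMatrixUnits e) (f : G) :
    IsMatrixUnits fun i j => f (e i j) := by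
  intro i j k l
  rw [← map_mul, he]
  split_ifs <;> simp

/-- The matrix units of a subalgebra isomorphic to a matrix algebra. -/
def matrixUnit {S : Subalgebra F A} {n : ℕ} (g : S ≃ₐ[F] Matrix (Fin n) (Fin n) F)
    (i j : Fin n) : A :=
  g.symm (Matrix.single i j 1)

variable {S : Subalgebra F A} {n : ℕ} (g : S ≃ₐ[F] Matrix (Fin n) (Fin n) F)

theorem matrixUnit_mem (i j : Fin n) : matrixUnit g i j ∈ S := SetLike.coe_mem _

theorem isMatrixUnits_matrixUnit : IsMatrixUnits (matrixUnit g) :=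
  isMatrixUnits_single.map (S.val.comp (g.symm : Matrix (Fin n) (Fin n) F →ₐ[F] S))

theorem sum_single_self {n : Type*} [DecidableEq n] [Fintype n] :
    ∑ i, Matrix.single i i (1 : F) = (1 : Matrix n n F) := by
  ext a b; simp [Matrix.sum_apply, Matrix.single_apply, Matrix.one_apply, ite_and]

theorem sum_matrixUnit_self : ∑ i, matrixUnit g i i = 1 := by
  have := congrArg (fun x => (g.symm x : A)) (sum_single_self (F := F) (n := Fin n))
  simpa [matrixUnit] using this

theorem eq_sum_matrixUnit (a : S) : (a : A) = ∑ i, ∑ j, g a i j • matrixUnit g i j := by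
  have h : g a = ∑ i, ∑ j, g a i j • Matrix.single i j (1 : F) := by
    conv_lhs => rw [Matrix.matrix_eq_sum_single (g a)]
    simp
  have h2 := congrArg (fun x => (g.symm x : A)) h
  simp only [AlgEquiv.symm_apply_apply, map_sum, map_smul, AddSubmonoidClass.coe_finsetSum,
    SetLike.val_smul] at h2
  exact h2

theorem mem_span_matrixUnit {a : A} (ha : a ∈ S) :
    a ∈ Submodule.span F (Set.range fun x : Fin n × Fin n => matrixUnit g x.1 x.2) := by
  rw [show a = _ from eq_sum_matrixUnit g ⟨a, ha⟩]
  exact Submodule.sum_mem _ fun i _ => Submodule.sum_mem _ fun j _ =>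
    Submodule.smul_mem _ _ (Submodule.subset_span ⟨(i, j), rfl⟩)

/-- Every element of a matrix subalgebra is equivalent to a sum of diagonal matrix units. -/
theorem exists_units_mul_eq_sum_matrixUnit {a : A} (ha : a ∈ S) :
    ∃ (u v : Sˣ) (s : Finset (Fin n)),
      a = u * (∑ i ∈ s, matrixUnit g i i) * v := by
  obtain ⟨V, U, s, -, h⟩ := exists_units_mul_eq_sum_single (g ⟨a, ha⟩)
  refine ⟨Units.map (g.symm : _ →* S) V, Units.map (g.symm : _ →* S) U, s, ?_⟩
  have h2 := congrArg (fun x => (g.symm x : A)) h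
  simpa [matrixUnit] using h2

/-- An idempotent factors through its range: `V` is the inclusion and `W` the projection, in
coordinates indexed by `κ`. -/
theorem exists_mul_eq_of_idempotent {n κ : Type*} [Fintype n] [DecidableEq n] [Fintype κ]
    [DecidableEq κ] {E : Matrix n n F} (hE : E * E = E) (hr : E.rank = Fintype.card κ) :
    ∃ (V : Matrix n κ F) (W : Matrix κ n F), V * W = E ∧ W * V = 1 := by
  have hc : Module.finrank F (κ → F) = Module.finrank F (LinearMap.range (Matrix.toLin' E)) := by
    rw [Module.finrank_fintype_fun_eq_card, ← hr]; rfl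
  let w := LinearEquiv.ofFinrankEq _ _ hc
  refine ⟨LinearMap.toMatrix' ((LinearMap.range (Matrix.toLin' E)).subtype ∘ₗ w.toLinearMap),
    LinearMap.toMatrix' (w.symm.toLinearMap ∘ₗ (Matrix.toLin' E).rangeRestrict), ?_, ?_⟩
  · rw [← LinearMap.toMatrix'_comp]
    conv_rhs => rw [← LinearMap.toMatrix'_toLin' E]
    congr 1
    refine LinearMap.ext fun x => ?_
    simp
  · rw [← LinearMap.toMatrix'_comp, ← LinearMap.toMatrix'_id]
    congr 1
    refine LinearMap.ext fun x => ?_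
    simp only [LinearMap.coe_comp, LinearEquiv.coe_coe, Function.comp_apply, LinearMap.id_apply]
    rw [LinearEquiv.symm_apply_eq]
    apply Subtype.ext
    obtain ⟨y, hy⟩ := (w x).2
    simp only [Submodule.subtype_apply, LinearMap.codRestrict_apply, LinearMap.rangeRestrict]
    rw [← hy, ← Matrix.toLin'_mul_apply, hE]

/-- An idempotent matrix of rank `k * s` is the sum of the diagonal elements of a `k × k` system of
matrix units. -/
theorem exists_isMatrixUnits_of_rank {n : Type*} [Fintype n] [DecidableEq n]
    {E : Matrix n n F} (hE : E * E = E) {k s : ℕ} (hr : E.rank = k * s) :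
    ∃ f : Fin k → Fin k → Matrix n n F, IsMatrixUnits f ∧ ∑ a, f a a = E := by
  obtain ⟨V, W, rfl, hW⟩ := exists_mul_eq_of_idempotent (κ := Fin k × Fin s) hE (by simp [hr])
  -- The units of size `k`, each repeated `s` times by a Kronecker product with the identity; `V`
  -- and `W` move them into the corner of `E`.
  let d : Fin k → Fin k → Matrix (Fin k × Fin s) (Fin k × Fin s) F := fun a b =>
    Matrix.kroneckerMap (· * ·) (Matrix.single a b (1 : F)) (1 : Matrix (Fin s) (Fin s) F)
  have hd : IsMatrixUnits d := by
    intro a b a' b'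
    simp only [d]
    rw [← Matrix.mul_kronecker_mul, isMatrixUnits_single, one_mul]
    split_ifs <;> simp
  have hs : ∑ a, d a a = 1 := by
    ext ⟨a, b⟩ ⟨c, e⟩
    simp [d, Matrix.sum_apply, Matrix.kroneckerMap_apply, Matrix.single_apply, Matrix.one_apply,
      ite_and]
    split_ifs <;> rfl
  refine ⟨fun a b => V * d a b * W, ?_, ?_⟩
  · intro a b a' b'
    have : V * d a b * W * (V * d a' b' * W) = V * (d a b * (W * V) * d a' b') * W := by
      simp only [Matrix.mul_assoc]
    rw [this, hW, mul_one, hd]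
    split_ifs <;> simp
  · rw [← Matrix.sum_mul, ← Matrix.mul_sum, hs, Matrix.mul_one]

/-- The version of `exists_isMatrixUnits_of_rank` for elements of a matrix subalgebra. -/
theorem exists_isMatrixUnits_of_mem {E : A} (hE : E * E = E) (hmem : E ∈ S) {k s : ℕ}
    (hr : (g ⟨E, hmem⟩).rank = k * s) :
    ∃ f : Fin k → Fin k → A, IsMatrixUnits f ∧ ∑ a, f a a = E ∧ ∀ a b, f a b ∈ S := by
  obtain ⟨f, hf, hs⟩ := exists_isMatrixUnits_of_rank (E := g ⟨E, hmem⟩)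
    (by rw [← map_mul]; exact congrArg g (Subtype.ext hE)) hr
  refine ⟨fun a b => g.symm (f a b),
    hf.map (S.val.comp (g.symm : Matrix (Fin n) (Fin n) F →ₐ[F] S)), ?_,
    fun a b => SetLike.coe_mem _⟩
  have h2 := congrArg (fun x => (g.symm x : A)) hs
  simpa using h2

include g in
/-- Matrix units of the right size span a matrix subalgebra. -/
theorem span_eq_of_isMatrixUnits {ι : Type*} [Fintype ι] [DecidableEq ι] {X : ι → ι → A}
    (hX : IsMatrixUnits X) (h0 : ∀ i, X i i ≠ 0) (hm : ∀ i j, X i j ∈ S)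
    (hc : Fintype.card ι = n) :
    Submodule.span F (Set.range fun x : ι × ι => X x.1 x.2) = Subalgebra.toSubmodule S := by
  have := finiteDimensional_of_equiv_matrix g
  have : FiniteDimensional F (Subalgebra.toSubmodule S) := this
  refine Submodule.eq_of_le_of_finrank_eq ?_ ?_
  · rw [Submodule.span_le]
    rintro _ ⟨x, rfl⟩
    exact hm _ _
  · rw [finrank_span_eq_card (hX.linearIndependent h0)]
    have h1 : Module.finrank F (Subalgebra.toSubmodule S) = Module.finrank F S := rfl
    rw [h1, g.toLinearEquiv.finrank_eq, Module.finrank_matrix]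
    simp [hc]

end

/-! ### Jordan relations and the homomorphic part -/

/-- The relations between the images of matrix units under a Jordan homomorphism. -/
structure IsJordanUnits {ι B : Type*} [Ring B] (x : ι → ι → B) : Prop where
  idem (i : ι) : x i i * x i i = x i i
  orth {i j : ι} : i ≠ j → x i i * x j j = 0
  left {i j : ι} : i ≠ j → x i i * x i j + x i j * x i i = x i j
  right {i j : ι} : i ≠ j → x j j * x i j + x i j * x j j = x i j
  sq {i j : ι} : i ≠ j → x i j * x i j = 0
  disj_left {i j k : ι} : i ≠ j → k ≠ i → k ≠ j → x k k * x i j = 0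
  disj_right {i j k : ι} : i ≠ j → k ≠ i → k ≠ j → x i j * x k k = 0
  comp {i j k : ι} : i ≠ j → j ≠ k → i ≠ k → x i j * x j k + x j k * x i j = x i k
  swap {i j : ι} : i ≠ j → x i j * x j i + x j i * x i j = x i i + x j j

/-- Multiplying by `p` on both sides gives `2 p y p = 0`, hence `p y p = 0`; multiplying on the left
only then gives `p y = 0`. -/
theorem mul_eq_zero_of_anticommute {B : Type*} [Ring B] (h2 : ∀ b : B, b + b = 0 → b = 0)
    {p y : B} (hp : p * p = p) (h : p * y + y * p = 0) : p * y = 0 ∧ y * p = 0 := by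
  have h1 : p * y * p = 0 := by
    apply h2
    have : p * (p * y + y * p) * p = 0 := by rw [h]; simp
    have e : p * (p * y + y * p) * p = (p * p) * y * p + p * y * (p * p) := by noncomm_ring
    rwa [e, hp] at this
  have h3 : p * (p * y + y * p) = 0 := by rw [h, mul_zero]
  rw [mul_add, ← mul_assoc, ← mul_assoc, hp, h1, add_zero] at h3
  rw [h3, zero_add] at h
  exact ⟨h3, h⟩

/-- Each relation comes from expanding `φ a * φ a = φ a` for an idempotent `a` that is a small
combination of units, and cancelling the relations already known. -/
theorem isJordanUnits_map {ι F A B : Type*} [DecidableEq ι] [Field F] [Ring A] [Algebra F A]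
    [Ring B] [Algebra F B] (h2 : ∀ b : B, b + b = 0 → b = 0) {e : ι → ι → A}
    (he : IsMatrixUnits e) {φ : A →ₗ[F] B} (hφ : ∀ a, a * a = a → φ a * φ a = φ a) :
    IsJordanUnits fun i j => φ (e i j) := by
  have he' : ∀ i j k l, e i j * e k l = if j = k then e i l else 0 := he
  have idem : ∀ i, φ (e i i) * φ (e i i) = φ (e i i) := fun i => hφ _ (he.mul_same i i i)
  have orth : ∀ {i j}, i ≠ j → φ (e i i) * φ (e j j) = 0 := by
    intro i j hij
    have h := hφ (e i i + e j j) (by simp [mul_add, add_mul, he', hij, hij.symm])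
    simp only [map_add, mul_add, add_mul, idem] at h
    refine (mul_eq_zero_of_anticommute h2 (idem i) (y := φ (e j j)) ?_).1
    linear_combination (norm := abel) h
  have row : ∀ {i j}, i ≠ j → φ (e i j) * φ (e i j) = 0 ∧
      φ (e i i) * φ (e i j) + φ (e i j) * φ (e i i) = φ (e i j) := by
    intro i j hij
    have h := hφ (e i i + e i j) (by simp [mul_add, add_mul, he', hij.symm])
    have h' := hφ (e i i - e i j) (by simp [mul_sub, sub_mul, he', hij.symm])
    simp only [map_add, mul_add, add_mul, map_sub, mul_sub, sub_mul, idem] at h h'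
    have hs : φ (e i j) * φ (e i j) = 0 := by
      apply h2
      linear_combination (norm := abel) h + h'
    refine ⟨hs, ?_⟩
    rw [hs] at h
    linear_combination (norm := abel) h
  have col : ∀ {i j}, i ≠ j →
      φ (e j j) * φ (e i j) + φ (e i j) * φ (e j j) = φ (e i j) := by
    intro i j hij
    have h := hφ (e j j + e i j) (by simp [mul_add, add_mul, he', hij.symm])
    simp only [map_add, mul_add, add_mul, idem, (row hij).1] at h
    linear_combination (norm := abel) h
  have disj : ∀ {i j k}, i ≠ j → k ≠ i → k ≠ j →
      φ (e k k) * φ (e i j) = 0 ∧ φ (e i j) * φ (e k k) = 0 := by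
    intro i j k hij hki hkj
    refine mul_eq_zero_of_anticommute h2 (idem k) ?_
    have h := hφ (e i i + e k k + e i j) (by
      simp [mul_add, add_mul, he', hij.symm, hki, hki.symm, hkj.symm])
    simp only [map_add, mul_add, add_mul, idem, (row hij).1, orth hki, orth hki.symm] at h
    linear_combination (norm := abel) h - (row hij).2
  have rows : ∀ {i j k}, i ≠ j → i ≠ k → j ≠ k →
      φ (e i j) * φ (e i k) + φ (e i k) * φ (e i j) = 0 := by
    intro i j k hij hik hjk
    have h := hφ (e i i + e i j + e i k) (by
      simp [mul_add, add_mul, he', hij.symm, hik.symm])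
    simp only [map_add, mul_add, add_mul, idem, (row hij).1, (row hik).1] at h
    linear_combination (norm := abel) h - (row hij).2 - (row hik).2
  have cols : ∀ {i j k}, i ≠ k → j ≠ k → i ≠ j →
      φ (e i k) * φ (e j k) + φ (e j k) * φ (e i k) = 0 := by
    intro i j k hik hjk hij
    have h := hφ (e k k + e i k + e j k) (by
      simp [mul_add, add_mul, he', hik.symm, hjk.symm])
    simp only [map_add, mul_add, add_mul, idem, (row hik).1, (row hjk).1] at h
    linear_combination (norm := abel) h - col hik - col hjk
  refine ⟨idem, orth, fun h => (row h).2, col, fun h => (row h).1, fun h h' h'' => (disj h h' h'').1,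
    fun h h' h'' => (disj h h' h'').2, ?_, ?_⟩
  · intro i j k hij hjk hik
    -- This idempotent is the product `(e i j + e j j) * (e j j + e j k)`; it has rank one and
    -- contains both factors of the wanted product.
    have h := hφ (e j j + e i j + e j k + e i k) (by
      simp [mul_add, add_mul, he', hij.symm, hjk.symm, hik.symm]; abel)
    simp only [map_add, mul_add, add_mul, idem, (row hij).1, (row hik).1, (row hjk).1] at h
    linear_combination (norm := abel) h - col hij - (row hjk).2 - (disj hik hij.symm hjk).1
      - (disj hik hij.symm hjk).2 - rows hij hik hjk - cols hjk hik hij.symm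
  · intro i j hij
    -- The 2 × 2 block with rows `(2, -2)` and `(1, -1)` has trace 1 and determinant 0. Both
    -- off-diagonal entries must be nonzero for the mixed products to appear, which excludes
    -- diagonal entries 0 and 1.
    have h := hφ (e i i + e i i - e i j - e i j + e j i - e j j) (by
      simp only [mul_add, add_mul, mul_sub, sub_mul, he', if_true, if_neg hij, if_neg hij.symm]
      abel)
    simp only [map_add, mul_add, add_mul, map_sub, mul_sub, sub_mul, idem, (row hij).1,
      (row hij.symm).1, orth hij, orth hij.symm] at h
    rw [← sub_eq_zero]
    apply h2
    linear_combination (norm := abel) -h - (row hij).2 - (row hij).2 - (row hij).2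
      - (row hij).2 + col hij + col hij + col hij.symm + col hij.symm - (row hij.symm).2

namespace IsJordanUnits

variable {ι B : Type*} [Ring B] {x : ι → ι → B} (hx : IsJordanUnits x)
include hx

/-- The relations are symmetric under reversing products, so every statement on the homomorphic part
yields one on the antihomomorphic part. -/
theorem op : IsJordanUnits fun i j => MulOpposite.op (x i j) where
  idem i := congrArg MulOpposite.op (hx.idem i)
  orth h := congrArg MulOpposite.op (hx.orth h.symm)
  left h := congrArg MulOpposite.op ((add_comm _ _).trans (hx.left h))
  right h := congrArg MulOpposite.op ((add_comm _ _).trans (hx.right h))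
  sq h := congrArg MulOpposite.op (hx.sq h)
  disj_left h h' h'' := congrArg MulOpposite.op (hx.disj_right h h' h'')
  disj_right h h' h'' := congrArg MulOpposite.op (hx.disj_left h h' h'')
  comp h h' h'' := congrArg MulOpposite.op ((add_comm _ _).trans (hx.comp h h' h''))
  swap h := congrArg MulOpposite.op ((add_comm _ _).trans (hx.swap h))

/-- Both sides equal `x i i * x i j * x j j`, by orthogonality of the diagonal elements. -/
theorem left_mul_eq {i j : ι} (h : i ≠ j) : x i i * x i j = x i j * x j j := by
  have h1 : x i i * x i j = x i i * x i j * x j j := by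
    conv_lhs => rw [← hx.right h]
    rw [mul_add, ← mul_assoc, hx.orth h, zero_mul, zero_add, mul_assoc]
  have h2 : x i j * x j j = x i i * x i j * x j j := by
    conv_lhs => rw [← hx.left h]
    rw [add_mul, mul_assoc (x i j), hx.orth h, mul_zero, add_zero]
  rw [h1, ← h2]

theorem right_mul_eq {i j : ι} (h : i ≠ j) : x j j * x i j = x i j * x i i := by
  have h3 := hx.right h
  have h4 := hx.left h
  rw [hx.left_mul_eq h] at h4
  linear_combination (norm := abel) h3 - h4

/-- The part of `x i j` that multiplies like a matrix unit, for `i ≠ j`. -/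
theorem hpart_mul {i j k : ι} (hij : i ≠ j) (hjk : j ≠ k) (hik : i ≠ k) :
    (x i i * x i j) * (x j j * x j k) = x i i * x i k := by
  have h := congrArg (x i i * ·) (hx.comp hij hjk hik)
  simp only [mul_add] at h
  rw [← mul_assoc, ← mul_assoc, hx.disj_left hjk hij hik, zero_mul, add_zero] at h
  rw [← h, ← mul_assoc, mul_assoc (x i i), ← hx.left_mul_eq hij, ← mul_assoc, hx.idem]

theorem hpart_swap {i j : ι} (hij : i ≠ j) :
    (x i i * x i j) * (x j j * x j i) = x i i * x i j * x j i := by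
  rw [← mul_assoc, mul_assoc (x i i), ← hx.left_mul_eq hij, ← mul_assoc, hx.idem]

theorem hpart_swap_eq {i j : ι} (hij : i ≠ j) :
    (x i i * x i j) * (x j j * x j i) = x i i - x j i * x i j * x i i := by
  have h := congrArg (x i i * ·) (hx.swap hij)
  simp only [mul_add, hx.idem, hx.orth hij, add_zero] at h
  have h3 : x j i * x i j * x i i = x i i * (x j i * x i j) := by
    rw [mul_assoc, ← hx.right_mul_eq hij, ← mul_assoc, ← mul_assoc, hx.right_mul_eq hij.symm]
  rw [hx.hpart_swap hij, h3, eq_sub_iff_add_eq, mul_assoc, h]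

theorem hpart_swap_mul {i j : ι} (hij : i ≠ j) :
    (x i i * x i j) * (x j j * x j i) * (x i i * x i j) = x i i * x i j := by
  rw [hx.hpart_swap_eq hij, sub_mul, ← mul_assoc, hx.idem]
  have : x j i * x i j * x i i * (x i i * x i j) = x j i * (x i j * x i j) * x j j := by
    rw [← mul_assoc, mul_assoc _ (x i i) (x i i), hx.idem, mul_assoc _ (x i i),
      hx.left_mul_eq hij]
    simp only [mul_assoc]
  rw [this, hx.sq hij]
  simp

/-- The diagonal element `h i j * h j i` does not depend on `j`. -/
theorem hpart_swap_indep {i j k : ι} (hij : i ≠ j) (hik : i ≠ k) :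
    (x i i * x i j) * (x j j * x j i) = (x i i * x i k) * (x k k * x k i) := by
  rcases eq_or_ne j k with rfl | hjk
  · rfl
  · rw [← hx.hpart_mul hjk hik.symm hij.symm, ← mul_assoc, hx.hpart_mul hij hjk hik]

variable [DecidableEq ι] {w : ι → ι} (hw : ∀ i, w i ≠ i)

omit hx in
/-- The homomorphic part of `x`; `w i` is an index different from `i`. -/
def _root_.jordanHomPart (x : ι → ι → B) (w : ι → ι) (i j : ι) : B :=
  if i = j then (x i i * x i (w i)) * (x (w i) (w i) * x (w i) i) else x i i * x i j

omit hx in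
theorem _root_.jordanHomPart_of_ne {i j : ι} (h : i ≠ j) :
    jordanHomPart x w i j = x i i * x i j := if_neg h

include hw

theorem jordanHomPart_self {i j : ι} (h : i ≠ j) :
    jordanHomPart x w i i = (x i i * x i j) * (x j j * x j i) := by
  rw [jordanHomPart, if_pos rfl, hx.hpart_swap_indep h (hw i).symm]

omit hw in
theorem self_mul_jordanHomPart (i j : ι) :
    x i i * jordanHomPart x w i j = jordanHomPart x w i j := by
  unfold jordanHomPart
  split_ifs <;> simp only [← mul_assoc, hx.idem]

theorem jordanHomPart_mul_self (i j : ι) :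
    jordanHomPart x w i j * x j j = jordanHomPart x w i j := by
  unfold jordanHomPart
  split_ifs with h
  · subst h
    rw [hx.left_mul_eq (hw i), mul_assoc, mul_assoc _ (x i i), hx.idem]
  · rw [hx.left_mul_eq h, mul_assoc, hx.idem]

/-- If the inner indices differ, the product vanishes because each factor absorbs its diagonal `x`
and these are orthogonal. Otherwise the identities for `x i i * x i j` apply; the diagonal elements
can be expressed through whichever second index is convenient (`jordanHomPart_self`). -/
theorem isMatrixUnits_jordanHomPart : IsMatrixUnits (jordanHomPart x w) := by
  intro i j k l
  by_cases hjk : j = k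
  · subst hjk
    rw [if_pos rfl]
    by_cases hij : i = j
    · subst hij
      by_cases hil : i = l
      · subst hil
        rw [hx.jordanHomPart_self hw (hw i).symm, ← mul_assoc, hx.hpart_swap_mul (hw i).symm]
      · rw [jordanHomPart_of_ne hil, hx.jordanHomPart_self hw hil, hx.hpart_swap_mul hil]
    · by_cases hjl : j = l
      · subst hjl
        rw [jordanHomPart_of_ne hij, hx.jordanHomPart_self hw (Ne.symm hij), ← mul_assoc,
          hx.hpart_swap_mul hij]
      · by_cases hil : i = l
        · subst hil
          rw [jordanHomPart_of_ne hij, jordanHomPart_of_ne hjl, hx.jordanHomPart_self hw hij]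
        · rw [jordanHomPart_of_ne hij, jordanHomPart_of_ne hjl, jordanHomPart_of_ne hil,
            hx.hpart_mul hij hjl hil]
  · rw [if_neg hjk, ← hx.jordanHomPart_mul_self hw i j, ← hx.self_mul_jordanHomPart k l,
      mul_assoc, ← mul_assoc (x j j), hx.orth hjk]
    simp

/-- Summed over `k`, this shows that the idempotent `∑ k, jordanHomPart x w k k` cuts the
homomorphic part out of `x`. Beyond absorption and orthogonality, the case `k = j` needs that `x i
j` squares to zero. -/
theorem jordanHomPart_self_mul (k i j : ι) :
    jordanHomPart x w k k * x i j = jordanHomPart x w k k * jordanHomPart x w i j := by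
  have hM := hx.isMatrixUnits_jordanHomPart hw
  rcases eq_or_ne i j with rfl | hij
  · rcases eq_or_ne k i with rfl | hki
    · rw [hM.mul_same, hx.jordanHomPart_mul_self hw]
    · rw [hM.mul_of_ne hki, ← hx.jordanHomPart_mul_self hw k, mul_assoc, hx.orth hki, mul_zero]
  · rcases eq_or_ne k i with rfl | hki
    · rw [jordanHomPart_of_ne hij, ← mul_assoc, hx.jordanHomPart_mul_self hw]
    rcases eq_or_ne k j with rfl | hkj
    · conv_lhs => rw [← hx.left hij, mul_add]
      rw [jordanHomPart_of_ne hij, add_eq_left, hx.jordanHomPart_self hw hij.symm,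
        hx.left_mul_eq hij, mul_assoc, mul_assoc (x i k), ← mul_assoc (x k k),
        hx.right_mul_eq hij, ← mul_assoc (x i k), ← mul_assoc (x i k), hx.sq hij]
      simp
    · rw [hM.mul_of_ne hki, ← hx.jordanHomPart_mul_self hw k, mul_assoc,
        hx.disj_left hij hki hkj, mul_zero]

theorem mul_jordanHomPart_self (k i j : ι) :
    x i j * jordanHomPart x w k k = jordanHomPart x w i j * jordanHomPart x w k k := by
  have hM := hx.isMatrixUnits_jordanHomPart hw
  rcases eq_or_ne i j with rfl | hij
  · rcases eq_or_ne k i with rfl | hki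
    · rw [hM.mul_same, hx.self_mul_jordanHomPart]
    · rw [hM.mul_of_ne hki.symm, ← hx.self_mul_jordanHomPart k, ← mul_assoc, hx.orth hki.symm,
        zero_mul]
  · rcases eq_or_ne k j with rfl | hkj
    · rw [jordanHomPart_of_ne hij, hx.left_mul_eq hij, mul_assoc, hx.self_mul_jordanHomPart]
    rcases eq_or_ne k i with rfl | hki
    · conv_lhs => rw [← hx.left hij, add_mul]
      rw [jordanHomPart_of_ne hij, add_eq_left, hx.jordanHomPart_self hw hij,
        hx.left_mul_eq hij, mul_assoc, ← mul_assoc (x k k), ← mul_assoc (x k k),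
        hx.left_mul_eq hij, mul_assoc (x k j) (x j j) (x j j), hx.idem, ← mul_assoc (x k j),
        ← mul_assoc (x k j), hx.sq hij]
      simp
    · rw [hM.mul_of_ne hkj.symm, ← hx.self_mul_jordanHomPart k, ← mul_assoc,
        hx.disj_right hij hki hkj, zero_mul]

theorem sum_jordanHomPart_mul [Fintype ι] (i j : ι) :
    (∑ k, jordanHomPart x w k k) * x i j = jordanHomPart x w i j := by
  rw [Finset.sum_mul, Finset.sum_congr rfl fun k _ => hx.jordanHomPart_self_mul hw k i j,
    ← Finset.sum_mul, (hx.isMatrixUnits_jordanHomPart hw).sum_mul]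

theorem mul_sum_jordanHomPart [Fintype ι] (i j : ι) :
    x i j * (∑ k, jordanHomPart x w k k) = jordanHomPart x w i j := by
  rw [Finset.mul_sum, Finset.sum_congr rfl fun k _ => hx.mul_jordanHomPart_self hw k i j,
    ← Finset.mul_sum, (hx.isMatrixUnits_jordanHomPart hw).mul_sum]

/-- What remains of `x` after removing its homomorphic part is the homomorphic part in the opposite
ring, so it multiplies like transposed matrix units. -/
theorem unop_jordanHomPart_op (i j : ι) :
    (jordanHomPart (fun i j => MulOpposite.op (x i j)) w i j).unop =
      x i j - jordanHomPart x w i j := by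
  rcases eq_or_ne i j with rfl | hij
  · rw [hx.jordanHomPart_self hw (hw i).symm, hx.hpart_swap_eq (hw i).symm, sub_sub_cancel,
      hx.op.jordanHomPart_self hw (hw i).symm]
    simp only [MulOpposite.unop_mul, MulOpposite.unop_op]
    rw [mul_assoc, ← mul_assoc (x (w i) (w i)), hx.right_mul_eq (hw i).symm,
      mul_assoc _ (x i i), hx.idem, mul_assoc]
  · rw [jordanHomPart_of_ne hij, jordanHomPart_of_ne hij]
    simp only [MulOpposite.unop_mul, MulOpposite.unop_op]
    rw [eq_sub_iff_add_eq, add_comm, hx.left hij]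

end IsJordanUnits

/-! ### Splitting into a homomorphism and an antihomomorphism -/

/-- On the subalgebra `S`, the unital map `φ` is the sum of a homomorphism and an antihomomorphism
into the corners that are given by the idempotent `P` and by `1 - P`. -/
structure IsJordanSplit {F A : Type*} [Field F] [Ring A] [Algebra F A] (S : Subalgebra F A)
    (φ : A →ₗ[F] A) (P : A) : Prop where
  idem : P * P = P
  map_one : φ 1 = 1
  comm {a : A} : a ∈ S → φ a * P = P * φ a
  hom {a b : A} : a ∈ S → b ∈ S → φ (a * b) * P = φ a * φ b * P
  anti {a b : A} : a ∈ S → b ∈ S → φ (a * b) * (1 - P) = φ b * φ a * (1 - P)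

/-- The conditions of `IsJordanSplit` can be checked on a spanning set. -/
theorem IsJordanSplit.of_span {F A : Type*} [Field F] [Ring A] [Algebra F A] {S : Subalgebra F A}
    {φ : A →ₗ[F] A} {P : A} {s : Set A} (hs : Submodule.span F s = Subalgebra.toSubmodule S)
    (idem : P * P = P) (map_one : φ 1 = 1) (comm : ∀ a ∈ s, φ a * P = P * φ a)
    (hom : ∀ a ∈ s, ∀ b ∈ s, φ (a * b) * P = φ a * φ b * P)
    (anti : ∀ a ∈ s, ∀ b ∈ s, φ (a * b) * (1 - P) = φ b * φ a * (1 - P)) :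
    IsJordanSplit S φ P where
  idem := idem
  map_one := map_one
  comm {a} ha := by
    rw [← Subalgebra.mem_toSubmodule, ← hs] at ha
    induction ha using Submodule.span_induction with
    | mem a ha => exact comm a ha
    | zero => simp
    | add a b _ _ ha hb => simp only [map_add, add_mul, mul_add, ha, hb]
    | smul c a _ ha => simp only [map_smul, smul_mul_assoc, mul_smul_comm, ha]
  hom {a b} ha hb := by
    rw [← Subalgebra.mem_toSubmodule, ← hs] at ha hb
    induction ha, hb using Submodule.span_induction₂ with
    | mem_mem a b ha hb => exact hom a ha b hb
    | zero_left => simp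
    | zero_right => simp
    | add_left a b c _ _ _ h1 h2 => simp only [map_add, add_mul, h1, h2]
    | add_right a b c _ _ _ h1 h2 => simp only [map_add, add_mul, mul_add, h1, h2]
    | smul_left c a b _ _ h => simp only [map_smul, smul_mul_assoc, h]
    | smul_right c a b _ _ h => simp only [map_smul, smul_mul_assoc, mul_smul_comm, h]
  anti {a b} ha hb := by
    rw [← Subalgebra.mem_toSubmodule, ← hs] at ha hb
    induction ha, hb using Submodule.span_induction₂ with
    | mem_mem a b ha hb => exact anti a ha b hb
    | zero_left => simp
    | zero_right => simp
    | add_left a b c _ _ _ h1 h2 =>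
      rw [add_mul, map_add, map_add, add_mul, mul_add, add_mul, h1, h2]
    | add_right a b c _ _ _ h1 h2 =>
      rw [mul_add, map_add, map_add, add_mul, add_mul, add_mul, h1, h2]
    | smul_left c a b _ _ h => simp only [map_smul, smul_mul_assoc, mul_smul_comm, h]
    | smul_right c a b _ _ h => simp only [map_smul, smul_mul_assoc, mul_smul_comm, h]

section

variable {F A : Type*} [Field F] [Ring A] [Algebra F A]

theorem span_matrixUnit {S : Subalgebra F A} {n : ℕ} (g : S ≃ₐ[F] Matrix (Fin n) (Fin n) F) :
    Submodule.span F (Set.range fun x : Fin n × Fin n => matrixUnit g x.1 x.2) =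
      Subalgebra.toSubmodule S := by
  refine le_antisymm (Submodule.span_le.2 ?_) fun a ha => mem_span_matrixUnit g ha
  rintro _ ⟨x, rfl⟩
  exact matrixUnit_mem g _ _

/-- The ranks of `a` and `1 - a` add up to 1, hence so do the ranks of their images, whose sum is 1.
-/
theorem PreservesNormalizedRank.map_mul_self (hA : IsLocallyMatrixAlgebra F A) {φ : A →ₗ[F] A}
    (hφ : PreservesNormalizedRank φ) (h1 : φ 1 = 1) {a : A} (ha : a * a = a) :
    φ a * φ a = φ a := by
  refine hA.mul_self_of_normalizedRank (q := φ (1 - a)) ?_ ?_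
  · rw [← map_add, add_sub_cancel, h1]
  · rw [hφ, hφ, ← hA.normalizedRank_add ha, add_sub_cancel, hA.normalizedRank_one]
    all_goals simp [mul_sub, sub_mul, ha]

/-- A unital linear map that preserves the normalized rank is, on each matrix subalgebra of size
at least two, the sum of a homomorphism and an antihomomorphism. -/
theorem PreservesNormalizedRank.exists_isJordanSplit (hA : IsLocallyMatrixAlgebra F A)
    (h2 : (2 : F) ≠ 0) {φ : A →ₗ[F] A} (hφ : PreservesNormalizedRank φ) (h1 : φ 1 = 1)
    {S : Subalgebra F A} {n : ℕ} (g : S ≃ₐ[F] Matrix (Fin n) (Fin n) F) (hn : 2 ≤ n) :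
    ∃ P : A, IsJordanSplit S φ P ∧ (∃ r : A, normalizedRank F P = n * normalizedRank F r) ∧
      ∀ Q, (∀ a ∈ S, φ a * Q = Q * φ a) → Q * P = P * Q := by
  have h2' : ∀ b : A, b + b = 0 → b = 0 := by
    intro b hb
    rw [← two_smul F] at hb
    exact (smul_eq_zero.1 hb).resolve_left h2
  have : Nontrivial (Fin n) := Fin.nontrivial_iff_two_le.2 hn
  choose w hw using fun i : Fin n => exists_ne i
  have he := isMatrixUnits_matrixUnit g
  set e := matrixUnit g with hedef
  have hx : IsJordanUnits fun i j => φ (e i j) :=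
    isJordanUnits_map h2' he fun a ha => hφ.map_mul_self hA h1 ha
  set x : Fin n → Fin n → A := fun i j => φ (e i j) with hxdef
  have hH := hx.isMatrixUnits_jordanHomPart hw
  have hG := hx.op.isMatrixUnits_jordanHomPart hw
  have hGe := hx.unop_jordanHomPart_op hw
  have hxP := hx.mul_sum_jordanHomPart hw
  have hPx := hx.sum_jordanHomPart_mul hw
  set H := jordanHomPart x w with hHdef
  set P := ∑ k, H k k with hPdef
  have hG' : ∀ i j k l, (x k l - H k l) * (x i j - H i j) = if j = k then x i l - H i l else 0 := by
    intro i j k l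
    rw [← hGe, ← hGe, ← MulOpposite.unop_mul, hG]
    split_ifs
    · rw [hGe]
    · rfl
  have hHP : ∀ i j, H i j * P = H i j := hH.mul_sum
  have hPH : ∀ i j, P * H i j = H i j := hH.sum_mul
  have hPP : P * P = P := by
    conv_lhs => rw [hPdef, Finset.mul_sum]
    exact Finset.sum_congr rfl fun k _ => hPH k k
  refine ⟨P, IsJordanSplit.of_span (span_matrixUnit g) hPP h1 ?_ ?_ ?_,
    ⟨H ⟨0, by omega⟩ ⟨0, by omega⟩, ?_⟩,
    ?_⟩
  · rintro _ ⟨⟨i, j⟩, rfl⟩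
    exact (hxP i j).trans (hPx i j).symm
  · rintro _ ⟨⟨i, j⟩, rfl⟩ _ ⟨⟨k, l⟩, rfl⟩
    change φ (e i j * e k l) * P = x i j * x k l * P
    rw [mul_assoc, hxP, ← hPH k l, ← mul_assoc, hxP, hH, he]
    split_ifs
    · exact hxP i l
    · simp
  · rintro _ ⟨⟨i, j⟩, rfl⟩ _ ⟨⟨k, l⟩, rfl⟩
    change φ (e i j * e k l) * (1 - P) = x k l * x i j * (1 - P)
    have hz : P * (x i j - H i j) = 0 := by rw [mul_sub, hPx, hPH, sub_self]
    have hx1 : ∀ i j, x i j * (1 - P) = x i j - H i j := fun i j => by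
      rw [mul_sub, mul_one, hxP]
    have hxl : x k l * (x i j - H i j) = (x k l - H k l) * (x i j - H i j) := by
      rw [sub_mul (x k l), ← hHP k l, mul_assoc _ P, hz, mul_zero, sub_zero]
    rw [mul_assoc, hx1, hxl, hG', he]
    split_ifs
    · exact hx1 i l
    · simp
  · rw [hPdef, hH.normalizedRank_sum hA Finset.univ ⟨0, by omega⟩]
    simp
  · intro Q hQ
    have hc : ∀ i j, Commute Q (x i j) := fun i j => (hQ _ (matrixUnit_mem g i j)).symm
    refine Commute.sum_right _ _ _ fun k _ => ?_
    rw [hHdef, hx.jordanHomPart_self hw (hw k).symm]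
    exact ((hc _ _).mul_right (hc _ _)).mul_right ((hc _ _).mul_right (hc _ _))

theorem IsJordanSplit.mono {S T : Subalgebra F A} {φ : A →ₗ[F] A} {P : A}
    (h : IsJordanSplit T φ P) (hST : S ≤ T) : IsJordanSplit S φ P where
  idem := h.idem
  map_one := h.map_one
  comm ha := h.comm (hST ha)
  hom ha hb := h.hom (hST ha) (hST hb)
  anti ha hb := h.anti (hST ha) (hST hb)

/-- A map on a matrix algebra of size at least two cannot be both a homomorphism and an
antihomomorphism. -/
theorem eq_zero_of_hom_of_anti {S : Subalgebra F A} {n : ℕ}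
    (g : S ≃ₐ[F] Matrix (Fin n) (Fin n) F) (hn : 2 ≤ n) {φ : A →ₗ[F] A} (h1 : φ 1 = 1) {z : A}
    (hz : ∀ a ∈ S, ∀ b ∈ S, φ (a * b) * z = φ a * φ b * z)
    (hz' : ∀ a ∈ S, ∀ b ∈ S, φ (a * b) * z = φ b * φ a * z) : z = 0 := by
  have : Nontrivial (Fin n) := Fin.nontrivial_iff_two_le.2 hn
  have he := isMatrixUnits_matrixUnit g
  have hm := matrixUnit_mem g
  have key : ∀ i, φ (matrixUnit g i i) * z = 0 := by
    intro i
    obtain ⟨j, hj⟩ := exists_ne i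
    -- The two multiplication rules send `e i j * e j i` and `e j i * e i j` to the same element
    -- after multiplication by `z`.
    have h3 : φ (matrixUnit g i i) * z = φ (matrixUnit g j j) * z := by
      rw [← he.mul_same i j i, hz _ (hm _ _) _ (hm _ _), ← hz' _ (hm _ _) _ (hm _ _), he.mul_same]
    calc φ (matrixUnit g i i) * z = φ (matrixUnit g i i) * φ (matrixUnit g i i) * z := by
          rw [← hz _ (hm _ _) _ (hm _ _), he.mul_same]
      _ = φ (matrixUnit g i i) * φ (matrixUnit g j j) * z := by rw [mul_assoc, h3, mul_assoc]
      _ = 0 := by rw [← hz _ (hm _ _) _ (hm _ _), he.mul_of_ne hj.symm, map_zero, zero_mul]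
  calc z = φ (∑ i, matrixUnit g i i) * z := by rw [sum_matrixUnit_self, h1, one_mul]
    _ = 0 := by rw [map_sum, Finset.sum_mul]; exact Finset.sum_eq_zero fun i _ => key i

/-- After multiplication by `P * (1 - Q)`, the map `φ` is both a homomorphism and an
antihomomorphism, so this element is zero; exchanging `P` and `Q` gives the rest. -/
theorem IsJordanSplit.unique {S : Subalgebra F A} {n : ℕ}
    (g : S ≃ₐ[F] Matrix (Fin n) (Fin n) F) (hn : 2 ≤ n) {φ : A →ₗ[F] A} {P Q : A}
    (hP : IsJordanSplit S φ P) (hQ : IsJordanSplit S φ Q) (hPQ : Q * P = P * Q) : P = Q := by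
  have key : ∀ {P Q : A}, IsJordanSplit S φ P → IsJordanSplit S φ Q → Q * P = P * Q →
      P * (1 - Q) = 0 := by
    intro P Q hP hQ hPQ
    refine eq_zero_of_hom_of_anti g hn hP.map_one (fun a ha b hb => ?_) fun a ha b hb => ?_
    · rw [← mul_assoc, hP.hom ha hb, mul_assoc]
    · have : P * (1 - Q) = (1 - Q) * P := by rw [mul_sub, sub_mul, hPQ]; simp
      rw [this, ← mul_assoc, hQ.anti ha hb, mul_assoc]
  have h1 := key hP hQ hPQ
  have h2 := key hQ hP hPQ.symm
  rw [mul_sub, mul_one, sub_eq_zero] at h1 h2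
  rw [h1, h2, hPQ]
  rw [← mul_assoc, hP.idem]

/-! ### Locally finite Steinitz numbers -/

theorem SteinitzNumber.IsLocallyFinite.exists_max
    (h : (steinitzNumber F A).IsLocallyFinite) (hA : IsLocallyMatrixAlgebra F A) {p : ℕ}
    (hp : p.Prime) :
    ∃ N ∈ matrixDegrees F A, ∀ M ∈ matrixDegrees F A, padicValNat p M ≤ padicValNat p N := by
  obtain ⟨S, n, e, hn, -⟩ := hA.exists_subalgebra_of_finite Set.finite_empty
  obtain ⟨k, hk⟩ := ENat.ne_top_iff_exists.1 (h ⟨p, hp⟩)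
  have hle : ∀ M ∈ matrixDegrees F A, padicValNat p M ≤ k := by
    intro M hM
    have : ((padicValNat p M : ℕ) : ℕ∞) ≤ steinitzNumber F A ⟨p, hp⟩ :=
      le_iSup₂ (f := fun n (_ : n ∈ matrixDegrees F A) => ((padicValNat p n : ℕ) : ℕ∞)) M hM
    rw [← hk] at this
    exact_mod_cast this
  have hb : BddAbove (padicValNat p '' matrixDegrees F A) :=
    ⟨k, by rintro _ ⟨M, hM, rfl⟩; exact hle M hM⟩
  have hne : (padicValNat p '' matrixDegrees F A).Nonempty := ⟨_, n, ⟨S, hn, ⟨e⟩⟩, rfl⟩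
  obtain ⟨N, hN, hNe⟩ := Nat.sSup_mem hne hb
  exact ⟨N, hN, fun M hM => hNe ▸ le_csSup hb ⟨M, hM, rfl⟩⟩

theorem IsLocallyMatrixAlgebra.exists_normalizedRank_eq (hA : IsLocallyMatrixAlgebra F A) (a : A) :
    ∃ t : ℕ, ∃ M ∈ matrixDegrees F A, 0 < M ∧ normalizedRank F a = t / M := by
  obtain ⟨S, n, e, hn, h⟩ := hA.exists_subalgebra_of_finite (Set.finite_singleton a)
  exact ⟨_, n, ⟨S, hn, ⟨e⟩⟩, hn, hA.normalizedRank_eq e hn (h rfl)⟩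

/-- A positive rational number `q ≤ 1` equals `1` if no prime divides its denominator, where the
latter is read off from fractions `m * t / M`. -/
theorem eq_one_of_padicValNat_le {q : ℚ} (h0 : 0 < q) (hle : q ≤ 1)
    (h : ∀ p : ℕ, p.Prime → ∃ m t M : ℕ, 0 < m ∧ 0 < M ∧ padicValNat p M ≤ padicValNat p m ∧
      q = m * (t / M)) : q = 1 := by
  have hden : q.den = 1 := by
    by_contra hne
    obtain ⟨p, hp, hpd⟩ := Nat.exists_prime_and_dvd hne
    have : Fact p.Prime := ⟨hp⟩
    obtain ⟨m, t, M, hm, hM, hv, hq⟩ := h p hp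
    have ht : t ≠ 0 := by
      rintro rfl
      simp at hq
      exact h0.ne' hq
    have hnum : 0 < q.num := Rat.num_pos.2 h0
    obtain ⟨c, hc⟩ := Int.eq_ofNat_of_zero_le hnum.le
    have hc0 : c ≠ 0 := by rintro rfl; simp [hc] at hnum
    have hcop : c.Coprime q.den := by simpa [hc] using q.reduced
    have hq' : (c : ℚ) / q.den = m * (t / M) := by
      rw [← hq]
      conv_rhs => rw [← Rat.num_div_den q, hc]
      rw [Int.cast_natCast]
    have hd0 : (q.den : ℚ) ≠ 0 := by exact_mod_cast q.den_nz
    have hM0 : (M : ℚ) ≠ 0 := by positivity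
    have hnat : c * M = m * t * q.den := by
      have : (c : ℚ) * M = m * t * q.den := by
        field_simp at hq'
        linear_combination hq'
      exact_mod_cast this
    -- As `p` divides `q.den` but not `c`, comparing valuations makes that of `M` exceed that of
    -- `m`, a contradiction.
    have hval := congrArg (padicValNat p) hnat
    rw [padicValNat.mul hc0 hM.ne', padicValNat.mul (mul_ne_zero hm.ne' ht) q.den_nz,
      padicValNat.mul hm.ne' ht, padicValNat.eq_zero_of_not_dvd
        (fun hpc => hp.one_lt.ne' (Nat.dvd_one.1 (hcop ▸ Nat.dvd_gcd hpc hpd)))] at hval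
    have := one_le_padicValNat_of_dvd q.den_nz hpd
    omega
  have hn : (q.num : ℚ) = q := Rat.coe_int_num_of_den_eq_one hden
  have h1 : 0 < q.num := Rat.num_pos.2 h0
  have h2 : q.num ≤ 1 := by
    have : (q.num : ℚ) ≤ 1 := hn ▸ hle
    exact_mod_cast this
  have : q.num = 1 := by omega
  rw [← hn, this]; rfl

/-- In a locally matrix algebra with locally finite Steinitz number, unital linear maps that
preserve the normalized rank are homomorphisms or antihomomorphisms. -/
theorem PreservesNormalizedRank.hom_or_antihom (hA : IsLocallyMatrixAlgebra F A)
    (h2 : (2 : F) ≠ 0) (hst : (steinitzNumber F A).IsLocallyFinite) {φ : A →ₗ[F] A}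
    (hφ : PreservesNormalizedRank φ) (h1 : φ 1 = 1) :
    IsAlgHomomorphism φ ∨ IsAlgAntihomomorphism φ := by
  by_cases hex : ∃ (S : Subalgebra F A) (n : ℕ) (_ : S ≃ₐ[F] Matrix (Fin n) (Fin n) F), 2 ≤ n
  · obtain ⟨S, n, g, hn⟩ := hex
    obtain ⟨P, hP, -, hcomm⟩ := hφ.exists_isJordanSplit hA h2 h1 g hn
    -- The idempotent belonging to `T` also splits `φ` on `S`, and it commutes with `φ` on `S`,
    -- hence with `P`; by uniqueness it is `P`.
    have key : ∀ {T : Subalgebra F A} {m : ℕ} (_ : T ≃ₐ[F] Matrix (Fin m) (Fin m) F), 0 < m →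
        S ≤ T → IsJordanSplit T φ P ∧ ∃ r : A, normalizedRank F P = m * normalizedRank F r := by
      intro T m f hm hST
      obtain ⟨Q, hQ, hr, -⟩ := hφ.exists_isJordanSplit hA h2 h1 f
        (hn.trans (Nat.le_of_dvd hm (dvd_of_le g f (by omega) hST)))
      rw [hP.unique g hn (hQ.mono hST) (hcomm Q fun a ha => hQ.comm (hST ha))]
      exact ⟨hQ, hr⟩
    have := finiteDimensional_of_equiv_matrix g
    have hsplit : ∀ a b, ∃ T : Subalgebra F A, a ∈ T ∧ b ∈ T ∧ IsJordanSplit T φ P := by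
      intro a b
      obtain ⟨T, m, f, hm, hs, hST, -⟩ := hA.exists_subalgebra_ge (Set.toFinite {a, b}) S S
      exact ⟨T, hs (by simp), hs (by simp), (key f hm hST).1⟩
    rcases (hA.normalizedRank_nonneg P).eq_or_lt with h0 | h0
    · right
      intro a b
      obtain ⟨T, ha, hb, hT⟩ := hsplit a b
      simpa [hA.eq_zero_of_normalizedRank h0.symm] using hT.anti ha hb
    · left
      have hone : normalizedRank F P = 1 := by
        refine eq_one_of_padicValNat_le h0 (hA.normalizedRank_le_one P) fun p hp => ?_
        have : Fact p.Prime := ⟨hp⟩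
        obtain ⟨N, ⟨S', hN, ⟨g'⟩⟩, hmax⟩ := hst.exists_max hA hp
        have := finiteDimensional_of_equiv_matrix g'
        -- `T` contains `S`, so the rank of `P` is `m` times that of some `r`; it contains `S'`, so
        -- `m` carries at least the power of `p` found in any denominator of `r`.
        obtain ⟨T, m, f, hm, -, hST, hST'⟩ := hA.exists_subalgebra_ge Set.finite_empty S S'
        obtain ⟨r, hr⟩ := (key f hm hST).2
        obtain ⟨t, M, hMD, hM, ht⟩ := hA.exists_normalizedRank_eq r
        refine ⟨m, t, M, hm, hM, (hmax M hMD).trans ?_, by rw [hr, ht]⟩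
        exact (padicValNat_dvd_iff_le hm.ne').1 (pow_padicValNat_dvd.trans (dvd_of_le g' f hN hST'))
      have hP1 : P = 1 :=
        (hA.isUnit_of_normalizedRank hone).mul_left_cancel (hP.idem.trans (mul_one P).symm)
      intro a b
      obtain ⟨T, ha, hb, hT⟩ := hsplit a b
      simpa [hP1] using hT.hom ha hb
  -- Only size 1 occurs, so every element is a scalar.
  · left
    intro a b
    obtain ⟨S, n, g, hn, hs⟩ := hA.exists_subalgebra_of_finite (Set.finite_singleton a)
    have hn1 : n = 1 := by
      by_contra hne
      exact hex ⟨S, n, g, by omega⟩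
    subst hn1
    have hsc : a = algebraMap F A (g ⟨a, hs rfl⟩ 0 0) := by
      have : (⟨a, hs rfl⟩ : S) = algebraMap F S (g ⟨a, hs rfl⟩ 0 0) := by
        apply g.injective
        rw [AlgEquiv.commutes]
        ext i j
        fin_cases i; fin_cases j
        simp [Matrix.algebraMap_matrix_apply]
      exact congrArg Subtype.val this
    rw [hsc, Algebra.algebraMap_eq_smul_one]
    simp [h1]

end

/-! ### Extending a split map to a larger matrix subalgebra -/

section

variable {F A : Type*} [Field F] [Ring A] [Algebra F A]

theorem IsMatrixUnits.normalizedRank_of_sum {ι : Type*} [Fintype ι] [DecidableEq ι]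
    {e : ι → ι → A} (he : IsMatrixUnits e) (hA : IsLocallyMatrixAlgebra F A) {P : A}
    (hP : ∑ i, e i i = P) (i : ι) :
    Fintype.card ι * normalizedRank F (e i i) = normalizedRank F P := by
  rw [← hP, he.normalizedRank_sum hA Finset.univ i, Finset.card_univ]

/-- The subalgebra of size `M` need not contain `E`. Enlarging it to one that does multiplies `M` by
some `d`, and the rank of `E` there is `k * (s * d)`. -/
theorem IsLocallyMatrixAlgebra.exists_isMatrixUnits (hA : IsLocallyMatrixAlgebra F A) {E : A}
    (hE : E * E = E) {M : ℕ} (hM : M ∈ matrixDegrees F A) {k s : ℕ}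
    (h : normalizedRank F E * M = k * s) :
    ∃ f : Fin k → Fin k → A, IsMatrixUnits f ∧ ∑ a, f a a = E := by
  obtain ⟨S, hM0, ⟨g⟩⟩ := hM
  have := finiteDimensional_of_equiv_matrix g
  obtain ⟨U, m, f, hm, hs, hSU, -⟩ := hA.exists_subalgebra_ge (Set.finite_singleton E) S S
  obtain ⟨d, rfl⟩ := dvd_of_le g f hM0 hSU
  rw [hA.normalizedRank_eq f hm (hs rfl)] at h
  have hd : d ≠ 0 := by rintro rfl; simp at hm
  have hM' : (M : ℚ) ≠ 0 := by positivity
  have hd' : (d : ℚ) ≠ 0 := by exact_mod_cast hd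
  have hr : (f ⟨E, hs rfl⟩).rank = k * (s * d) := by
    push_cast at h
    field_simp at h
    have : ((f ⟨E, hs rfl⟩).rank : ℚ) = k * (s * d) := by rw [h]; ring
    exact_mod_cast this
  obtain ⟨x, hx, hsum, -⟩ := exists_isMatrixUnits_of_mem f hE (hs rfl) hr
  exact ⟨x, hx, hsum⟩

theorem exists_linearMap_of_linearIndependent {ι : Type*} {v : ι → A}
    (hv : LinearIndependent F v) (w : ι → A) : ∃ φ : A →ₗ[F] A, ∀ i, φ (v i) = w i := by
  obtain ⟨φ, hφ⟩ := ((Module.Basis.span hv).constr F w).exists_extend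
  refine ⟨φ, fun i => ?_⟩
  have := LinearMap.congr_fun hφ (Module.Basis.span hv i)
  rw [Module.Basis.constr_basis] at this
  rw [← this, LinearMap.comp_apply, Submodule.subtype_apply, Module.Basis.span_apply]

theorem IsMatrixUnits.sum_refine {ι κ : Type*} [Fintype ι] [Fintype κ] [DecidableEq ι]
    {e : ι → ι → A} (he : IsMatrixUnits e) {i₀ : ι} {f : κ → κ → A}
    (h : ∑ a, f a a = e i₀ i₀) :
    ∑ x : ι × κ, e x.1 i₀ * f x.2 x.2 * e i₀ x.1 = ∑ i, e i i := by
  rw [Fintype.sum_prod_type]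
  exact Finset.sum_congr rfl fun i _ => he.refine_sum h i i

/-- A map of matrix units `X x y ↦ X' x y + X'' y x` is the sum of a homomorphism and an
antihomomorphism. -/
theorem isJordanSplit_of_isMatrixUnits {ι : Type*} [Fintype ι] [DecidableEq ι]
    {X X' X'' : ι → ι → A} (hX : IsMatrixUnits X) (hX' : IsMatrixUnits X')
    (hX'' : IsMatrixUnits X'') {T : Subalgebra F A} {P : A} (h1 : ∑ x, X x x = 1)
    (h1' : ∑ x, X' x x = P) (h1'' : ∑ x, X'' x x = 1 - P)
    (hT : Submodule.span F (Set.range fun x : ι × ι => X x.1 x.2) = Subalgebra.toSubmodule T)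
    {φ : A →ₗ[F] A} (hφ : ∀ x y, φ (X x y) = X' x y + X'' y x) : IsJordanSplit T φ P := by
  have hP' : ∀ x y, X' x y * P = X' x y := fun x y => h1' ▸ hX'.mul_sum x y
  have hP'l : ∀ x y, P * X' x y = X' x y := fun x y => h1' ▸ hX'.sum_mul x y
  have hP'' : ∀ x y, X'' x y * P = 0 := fun x y => by
    have := hX''.mul_sum x y
    rwa [h1'', mul_sub, mul_one, sub_eq_self] at this
  have hP''l : ∀ x y, P * X'' x y = 0 := fun x y => by
    have := hX''.sum_mul x y
    rwa [h1'', sub_mul, one_mul, sub_eq_self] at this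
  have hPP : P * P = P := by
    conv_lhs => rw [← h1', Finset.sum_mul]
    rw [Finset.sum_congr rfl fun x _ => h1' ▸ hP' x x, h1']
  have hc : ∀ x y z w, X' x y * X'' z w = 0 := fun x y z w => by
    rw [← hP' x y, mul_assoc, hP''l, mul_zero]
  have hc' : ∀ x y z w, X'' x y * X' z w = 0 := fun x y z w => by
    rw [← hP'l z w, ← mul_assoc, hP'', zero_mul]
  refine IsJordanSplit.of_span hT hPP ?_ ?_ ?_ ?_
  · rw [← h1, map_sum, Finset.sum_congr rfl fun x _ => hφ x x, Finset.sum_add_distrib, h1', h1'',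
      add_sub_cancel, h1]
  · rintro _ ⟨⟨i, j⟩, rfl⟩
    simp only [hφ, add_mul, mul_add, hP', hP'l, hP'', hP''l]
  · rintro _ ⟨⟨i, j⟩, rfl⟩ _ ⟨⟨k, l⟩, rfl⟩
    change φ (X i j * X k l) * P = φ (X i j) * φ (X k l) * P
    rw [mul_assoc, hφ k l, add_mul, hP', hP'', add_zero, hφ i j, add_mul, hc', add_zero, hX, hX']
    split_ifs
    · rw [hφ, add_mul, hP', hP'', add_zero]
    · simp
  · rintro _ ⟨⟨i, j⟩, rfl⟩ _ ⟨⟨k, l⟩, rfl⟩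
    change φ (X i j * X k l) * (1 - P) = φ (X k l) * φ (X i j) * (1 - P)
    have hQ : ∀ x y, φ (X x y) * (1 - P) = X'' y x := fun x y => by
      rw [mul_sub, mul_one, hφ, add_mul, hP', hP'']; abel
    rw [mul_assoc, hQ, hφ k l, add_mul, hc, zero_add, hX, hX'']
    by_cases hjk : j = k
    · rw [if_pos hjk, if_pos hjk.symm, hQ]
    · rw [if_neg hjk, if_neg (Ne.symm hjk), map_zero, zero_mul]

/-- A sum of a homomorphism and an antihomomorphism extends from a matrix subalgebra to a larger
one if the corner of `P` has enough room. -/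
theorem IsJordanSplit.extend (hA : IsLocallyMatrixAlgebra F A) {p : ℕ} (hp : 0 < p) {P : A}
    (hP : normalizedRank F P = 1 / p)
    (hdiv : ∀ m ∈ matrixDegrees F A, ∃ M ∈ matrixDegrees F A, p * m ∣ M)
    {S T : Subalgebra F A} {n m : ℕ} (g : S ≃ₐ[F] Matrix (Fin n) (Fin n) F)
    (f : T ≃ₐ[F] Matrix (Fin m) (Fin m) F) (hn : 0 < n) (hm : 0 < m) (hST : S ≤ T)
    {φ : A →ₗ[F] A} (h : IsJordanSplit S φ P) :
    ∃ φ' : A →ₗ[F] A, IsJordanSplit T φ' P ∧ ∀ a ∈ S, φ' a = φ a := by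
  obtain ⟨k, rfl⟩ := dvd_of_le g f hn hST
  obtain ⟨M, hMD, ⟨c, rfl⟩⟩ := hdiv _ ⟨T, hm, ⟨f⟩⟩
  have hn' : (n : ℚ) ≠ 0 := by positivity
  have hp' : (p : ℚ) ≠ 0 := by positivity
  have he := isMatrixUnits_matrixUnit g
  have hmem := matrixUnit_mem g
  have hsum := sum_matrixUnit_self g
  set e := matrixUnit g with hedef
  have hPQ : P * (1 - P) = 0 := by rw [mul_sub, mul_one, h.idem, sub_self]
  have hQQ : (1 - P) * (1 - P) = 1 - P := by rw [sub_mul, one_mul, hPQ, sub_zero]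
  have hcQ : ∀ {a}, a ∈ S → φ a * (1 - P) = (1 - P) * φ a := fun ha => by
    rw [mul_sub, sub_mul, h.comm ha, mul_one, one_mul]
  have hrQ : normalizedRank F (1 - P) = (p - 1) / p := by
    have := hA.normalizedRank_add h.idem hQQ hPQ (by rw [sub_mul, one_mul, h.idem, sub_self])
    rw [add_sub_cancel, hA.normalizedRank_one, hP] at this
    field_simp at this ⊢
    linear_combination -this
  -- The images of the units in the two corners; the indices of `e''` are exchanged because `φ`
  -- reverses products there.
  set e' : Fin n → Fin n → A := fun i j => φ (e i j) * P with he'def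
  set e'' : Fin n → Fin n → A := fun i j => φ (e j i) * (1 - P) with he''def
  have he' : IsMatrixUnits e' := by
    intro i j k l
    simp only [he'def]
    rw [mul_assoc, ← mul_assoc P, ← h.comm (hmem k l), mul_assoc _ P P, h.idem, ← mul_assoc,
      ← h.hom (hmem _ _) (hmem _ _), he]
    split_ifs <;> simp
  have he'' : IsMatrixUnits e'' := by
    intro i j k l
    simp only [he''def]
    rw [mul_assoc, ← mul_assoc (1 - P), ← hcQ (hmem l k), mul_assoc _ (1 - P) (1 - P), hQQ,
      ← mul_assoc, ← h.anti (hmem _ _) (hmem _ _), he]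
    by_cases hjk : j = k
    · rw [if_pos hjk, if_pos hjk.symm]
    · rw [if_neg hjk, if_neg (Ne.symm hjk), map_zero, zero_mul]
  have hs' : ∑ i, e' i i = P := by
    simp only [he'def]
    rw [← Finset.sum_mul, ← map_sum, hsum, h.map_one, one_mul]
  have hs'' : ∑ i, e'' i i = 1 - P := by
    simp only [he''def]
    rw [← Finset.sum_mul, ← map_sum, hsum, h.map_one, one_mul]
  let i₀ : Fin n := ⟨0, hn⟩
  obtain ⟨x, hx, hxs, hxT⟩ := exists_isMatrixUnits_of_mem f (he.mul_same i₀ i₀ i₀)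
    (hST (hmem i₀ i₀)) (k := k) (s := 1) (by
      have h1 := he.normalizedRank_of_sum hA hsum i₀
      rw [hA.normalizedRank_eq f hm (hST (hmem i₀ i₀)), hA.normalizedRank_one,
        Fintype.card_fin] at h1
      have hk : k ≠ 0 := by rintro rfl; simp at hm
      have hk' : (k : ℚ) ≠ 0 := by exact_mod_cast hk
      push_cast at h1
      field_simp at h1
      rw [mul_one]
      exact_mod_cast h1)
  -- `e' i₀ i₀` has rank `1 / (p * n)` and the chosen degree is `p * (n * k) * c`, so the
  -- multiplicity is `c`. In the other corner the rank is `p - 1` times as large.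
  obtain ⟨x', hx', hxs'⟩ := hA.exists_isMatrixUnits (he'.mul_same i₀ i₀ i₀) hMD (k := k) (s := c)
    (by
      have h1 := he'.normalizedRank_of_sum hA hs' i₀
      rw [hP, Fintype.card_fin] at h1
      rw [eq_div_iff hp'] at h1
      push_cast
      linear_combination (k * c : ℚ) * h1)
  obtain ⟨x'', hx'', hxs''⟩ := hA.exists_isMatrixUnits (he''.mul_same i₀ i₀ i₀) hMD (k := k)
    (s := (p - 1) * c) (by
      have h1 := he''.normalizedRank_of_sum hA hs'' i₀
      rw [hrQ, Fintype.card_fin] at h1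
      rw [eq_div_iff hp'] at h1
      rw [Nat.cast_mul (p - 1), Nat.cast_pred hp]
      push_cast
      linear_combination (k * c : ℚ) * h1)
  have hX := he.refine hx hxs
  have hX' := he'.refine hx' hxs'
  have hX'' := he''.refine hx'' hxs''
  have hXs := (he.sum_refine hxs).trans hsum
  have hXs' := (he'.sum_refine hxs').trans hs'
  have hXs'' := (he''.sum_refine hxs'').trans hs''
  have hXm : ∀ y z : Fin n × Fin k, e y.1 i₀ * x y.2 z.2 * e i₀ z.1 ∈ T := fun y z =>
    mul_mem (mul_mem (hST (hmem _ _)) (hxT _ _)) (hST (hmem _ _))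
  set X : Fin n × Fin k → Fin n × Fin k → A := fun y z => e y.1 i₀ * x y.2 z.2 * e i₀ z.1
    with hXdef
  set X' : Fin n × Fin k → Fin n × Fin k → A := fun y z => e' y.1 i₀ * x' y.2 z.2 * e' i₀ z.1
    with hXdef'
  set X'' : Fin n × Fin k → Fin n × Fin k → A :=
    fun y z => e'' y.1 i₀ * x'' y.2 z.2 * e'' i₀ z.1 with hXdef''
  have hX0 : ∀ y, X y y ≠ 0 := by
    intro y hy
    have := hX.normalizedRank_of_sum hA hXs y
    rw [hy, hA.normalizedRank_zero, hA.normalizedRank_one] at this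
    simp at this
  -- The refined units span `T`, and `e i j` is the sum of the `X (i, b) (j, b)`, with analogous
  -- sums in the corners; so this map agrees with `φ` on `S`.
  obtain ⟨φ', hφ'⟩ := exists_linearMap_of_linearIndependent (hX.linearIndependent (F := F) hX0)
    fun y => X' y.1 y.2 + X'' y.2 y.1
  have hφ : ∀ y z, φ' (X y z) = X' y z + X'' z y := fun y z => hφ' (y, z)
  refine ⟨φ', isJordanSplit_of_isMatrixUnits hX hX' hX'' hXs hXs' hXs''
    (span_eq_of_isMatrixUnits f hX hX0 hXm (by simp)) hφ, fun a ha => ?_⟩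
  replace ha := mem_span_matrixUnit g ha
  induction ha using Submodule.span_induction with
  | mem a ha =>
    obtain ⟨⟨i, j⟩, rfl⟩ := ha
    change φ' (e i j) = φ (e i j)
    calc φ' (e i j) = φ' (∑ b, X (i, b) (j, b)) := by rw [← he.refine_sum hxs i j]
      _ = ∑ b, X' (i, b) (j, b) + ∑ b, X'' (j, b) (i, b) := by
        rw [map_sum, ← Finset.sum_add_distrib]
        exact Finset.sum_congr rfl fun b _ => hφ _ _
      _ = e' i j + e'' j i := by rw [← he'.refine_sum hxs' i j, ← he''.refine_sum hxs'' j i]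
      _ = φ (e i j) := by simp only [he'def, he''def, ← mul_add, add_sub_cancel, mul_one]
  | zero => simp
  | add a b _ _ iha ihb => rw [map_add, map_add, iha, ihb]
  | smul c a _ iha => rw [map_smul, map_smul, iha]

end

/-! ### Gluing along a chain and preservation of rank -/

section

variable {F A : Type*} [Field F] [Ring A] [Algebra F A]

/-- Compatible linear maps on an exhausting chain of subalgebras glue. -/
theorem exists_linearMap_of_chain {S : ℕ → Subalgebra F A} (hS : Monotone S)
    (htop : ∀ a, ∃ i, a ∈ S i) {φ : ℕ → A →ₗ[F] A}
    (hφ : ∀ i, ∀ a ∈ S i, φ (i + 1) a = φ i a) :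
    ∃ ψ : A →ₗ[F] A, ∀ i, ∀ a ∈ S i, ψ a = φ i a := by
  have hle : ∀ i j, i ≤ j → ∀ a ∈ S i, φ j a = φ i a := by
    intro i j hij a ha
    induction j, hij using Nat.le_induction with
    | base => rfl
    | succ j hij ih => rw [hφ j a (hS hij ha), ih]
  choose N hN using htop
  have key : ∀ i, ∀ a ∈ S i, φ (N a) a = φ i a := fun i a ha =>
    (hle _ _ (le_max_left (N a) i) a (hN a)).symm.trans (hle _ _ (le_max_right (N a) i) a ha)
  refine ⟨{ toFun := fun a => φ (N a) a, map_add' := fun a b => ?_, map_smul' := fun c a => ?_ },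
    key⟩
  · have ha := hS (le_max_left (N a) (N b)) (hN a)
    have hb := hS (le_max_right (N a) (N b)) (hN b)
    rw [key _ _ ha, key _ _ hb, key _ _ (add_mem ha hb), map_add]
  · rw [key _ _ (Subalgebra.smul_mem _ (hN a) c), map_smul, RingHom.id_apply]

/-- A sum of a homomorphism and an antihomomorphism into complementary corners of a locally matrix
algebra of countable dimension. -/
theorem IsLocallyMatrixAlgebra.exists_isJordanSplit_top (hA : IsLocallyMatrixAlgebra F A)
    (hdim : Module.rank F A = Cardinal.aleph0) {p : ℕ} (hp : 0 < p) {P : A} (hPP : P * P = P)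
    (hP : normalizedRank F P = 1 / p)
    (hdiv : ∀ m ∈ matrixDegrees F A, ∃ M ∈ matrixDegrees F A, p * m ∣ M) :
    ∃ φ : A →ₗ[F] A, IsJordanSplit ⊤ φ P := by
  have := hA.nontrivial
  let b := Module.Basis.ofVectorSpace F A
  have hcard : Cardinal.mk (Module.Basis.ofVectorSpaceIndex F A) = Cardinal.aleph0 :=
    b.mk_eq_rank''.trans hdim
  have : Countable (Module.Basis.ofVectorSpaceIndex F A) := Cardinal.mk_le_aleph0_iff.1 hcard.le
  have : Nonempty (Module.Basis.ofVectorSpaceIndex F A) := b.index_nonempty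
  obtain ⟨u, hu⟩ := exists_surjective_nat (Module.Basis.ofVectorSpaceIndex F A)
  -- A stage of the construction: a matrix subalgebra with a map that splits on it. Each step takes
  -- in one more basis vector.
  let D := {x : Subalgebra F A × (A →ₗ[F] A) // (∃ (n : ℕ)
    (_ : x.1 ≃ₐ[F] Matrix (Fin n) (Fin n) F), 0 < n) ∧ IsJordanSplit x.1 x.2 P}
  have hstep : ∀ (x : D) (a : A), ∃ y : D, x.1.1 ≤ y.1.1 ∧ a ∈ y.1.1 ∧
      ∀ c ∈ x.1.1, y.1.2 c = x.1.2 c := by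
    rintro ⟨⟨S, φ⟩, ⟨n, g, hn⟩, h⟩ a
    have := finiteDimensional_of_equiv_matrix g
    obtain ⟨T, m, f, hm, hs, hST, -⟩ := hA.exists_subalgebra_ge (Set.finite_singleton a) S S
    obtain ⟨φ', h', hφ'⟩ := IsJordanSplit.extend hA hp hP hdiv g f hn hm hST h
    exact ⟨⟨⟨T, φ'⟩, ⟨m, f, hm⟩, h'⟩, hST, hs rfl, hφ'⟩
  choose step hle hmem hagree using hstep
  -- On scalars the identity is a homomorphism and an antihomomorphism, so any idempotent `P` can
  -- start the chain.
  have hbot : IsJordanSplit (⊥ : Subalgebra F A) (LinearMap.id : A →ₗ[F] A) P := by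
    refine ⟨hPP, rfl, fun ha => ?_, fun _ _ => rfl, fun ha _ => ?_⟩
    · obtain ⟨c, rfl⟩ := Algebra.mem_bot.1 ha
      exact Algebra.commutes c P
    · obtain ⟨c, rfl⟩ := Algebra.mem_bot.1 ha
      simp only [LinearMap.id_apply, Algebra.commutes]
  have hone : Function.Bijective (Algebra.ofId F (Matrix (Fin 1) (Fin 1) F)) := by
    refine ⟨(algebraMap F (Matrix (Fin 1) (Fin 1) F)).injective, fun y => ⟨y 0 0, ?_⟩⟩
    ext i j
    fin_cases i; fin_cases j
    simp [Algebra.ofId_apply, Matrix.algebraMap_matrix_apply]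
  let x₀ : D := ⟨⟨⊥, LinearMap.id⟩, ⟨1, (Algebra.botEquiv F A).trans
    (AlgEquiv.ofBijective _ hone), one_pos⟩, hbot⟩
  let x : ℕ → D := fun i => Nat.rec x₀ (fun i y => step y (b (u i))) i
  have hmono : Monotone fun i => (x i).1.1 := monotone_nat_of_le_succ fun i => hle _ _
  have htop : ∀ a, ∃ i, a ∈ (x i).1.1 := by
    intro a
    induction b.mem_span a using Submodule.span_induction with
    | mem a ha =>
      obtain ⟨k, rfl⟩ := ha
      obtain ⟨i, rfl⟩ := hu k
      exact ⟨i + 1, hmem _ _⟩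
    | zero => exact ⟨0, zero_mem _⟩
    | add a c _ _ ha hc =>
      obtain ⟨i, hi⟩ := ha
      obtain ⟨j, hj⟩ := hc
      exact ⟨max i j, add_mem (hmono (le_max_left i j) hi) (hmono (le_max_right i j) hj)⟩
    | smul r a _ ha =>
      obtain ⟨i, hi⟩ := ha
      exact ⟨i, Subalgebra.smul_mem _ hi r⟩
  obtain ⟨ψ, hψ⟩ := exists_linearMap_of_chain (φ := fun i => (x i).1.2) hmono htop
    fun i => hagree (x i) _
  have htwo : ∀ a c, ∃ i, a ∈ (x i).1.1 ∧ c ∈ (x i).1.1 := by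
    intro a c
    obtain ⟨i, hi⟩ := htop a
    obtain ⟨j, hj⟩ := htop c
    exact ⟨max i j, hmono (le_max_left i j) hi, hmono (le_max_right i j) hj⟩
  refine ⟨ψ, hPP, ?_, fun {a} _ => ?_, fun {a c} _ _ => ?_, fun {a c} _ _ => ?_⟩
  · rw [hψ 0 1 (one_mem _)]
    rfl
  · obtain ⟨i, hi⟩ := htop a
    rw [hψ i a hi]
    exact (x i).2.2.comm hi
  · obtain ⟨i, hi, hj⟩ := htwo a c
    rw [hψ i a hi, hψ i c hj, hψ i _ (mul_mem hi hj)]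
    exact (x i).2.2.hom hi hj
  · obtain ⟨i, hi, hj⟩ := htwo a c
    rw [hψ i a hi, hψ i c hj, hψ i _ (mul_mem hi hj)]
    exact (x i).2.2.anti hi hj

/-- The element that equals `φ a` in the corner of `P` and `φ b` in the corner of `1 - P`. -/
def splitPair (φ : A →ₗ[F] A) (P a b : A) : A := φ a * P + φ b * (1 - P)

theorem splitPair_self (φ : A →ₗ[F] A) (P a : A) : splitPair φ P a a = φ a := by
  rw [splitPair, ← mul_add, add_sub_cancel, mul_one]

/-- The corners annihilate each other, so `splitPair` is multiplicative on the product of `A` and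
its opposite. -/
theorem IsJordanSplit.splitPair_mul {φ : A →ₗ[F] A} {P : A} (h : IsJordanSplit ⊤ φ P)
    (a b c d : A) : splitPair φ P a b * splitPair φ P c d = splitPair φ P (a * c) (d * b) := by
  have hPQ : P * (1 - P) = 0 := by rw [mul_sub, mul_one, h.idem, sub_self]
  have hQP : (1 - P) * P = 0 := by rw [sub_mul, one_mul, h.idem, sub_self]
  have hQQ : (1 - P) * (1 - P) = 1 - P := by rw [sub_mul, one_mul, hPQ, sub_zero]
  have hc : ∀ a, φ a * P = P * φ a := fun a => h.comm (Algebra.mem_top)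
  have hcQ : ∀ a, φ a * (1 - P) = (1 - P) * φ a := fun a => by
    rw [mul_sub, sub_mul, hc, mul_one, one_mul]
  have h1 : φ a * P * (φ c * P) = φ (a * c) * P := by
    rw [h.hom Algebra.mem_top Algebra.mem_top, mul_assoc, ← mul_assoc P, ← hc, mul_assoc _ P,
      h.idem, mul_assoc]
  have h2 : φ b * (1 - P) * (φ d * (1 - P)) = φ (d * b) * (1 - P) := by
    rw [h.anti Algebra.mem_top Algebra.mem_top, mul_assoc, ← mul_assoc (1 - P), ← hcQ,
      mul_assoc _ (1 - P), hQQ, mul_assoc]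
  have h3 : φ a * P * (φ d * (1 - P)) = 0 := by
    rw [hcQ, mul_assoc, ← mul_assoc P, hPQ, zero_mul, mul_zero]
  have h4 : φ b * (1 - P) * (φ c * P) = 0 := by
    rw [hc, mul_assoc, ← mul_assoc (1 - P), hQP, zero_mul, mul_zero]
  rw [splitPair, splitPair, add_mul, mul_add, mul_add, h1, h2, h3, h4, splitPair]
  abel

/-- Write `a` as a diagonal idempotent between two units. Its image is the image of that idempotent
between two units, and the diagonal units go to the diagonal of a system of matrix units of the same
size, again with sum 1. -/
theorem IsJordanSplit.preservesNormalizedRank (hA : IsLocallyMatrixAlgebra F A)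
    {φ : A →ₗ[F] A} {P : A} (h : IsJordanSplit ⊤ φ P) : PreservesNormalizedRank φ := by
  intro a
  obtain ⟨S, n, g, hn, hs⟩ := hA.exists_subalgebra_of_finite (Set.finite_singleton a)
  obtain ⟨u, v, s, rfl⟩ := exists_units_mul_eq_sum_matrixUnit g (hs rfl)
  have he := isMatrixUnits_matrixUnit g
  have hsum := sum_matrixUnit_self g
  set e := matrixUnit g
  let U : Sˣ → Sˣ → Aˣ := fun u v =>
    { val := splitPair φ P (u : S) (v : S)
      inv := splitPair φ P ((u⁻¹ : Sˣ) : S) ((v⁻¹ : Sˣ) : S)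
      val_inv := by
        rw [h.splitPair_mul, ← MulMemClass.coe_mul, ← MulMemClass.coe_mul]
        simp [splitPair_self, h.map_one]
      inv_val := by
        rw [h.splitPair_mul, ← MulMemClass.coe_mul, ← MulMemClass.coe_mul]
        simp [splitPair_self, h.map_one] }
  -- In the corner of `1 - P` the order is reversed, hence the exchanged arguments in `U v u`.
  have hφ : φ ((u : S) * (∑ i ∈ s, e i i) * (v : S)) =
      U u v * φ (∑ i ∈ s, e i i) * U v u := by
    change _ = splitPair φ P _ _ * _ * splitPair φ P _ _
    rw [← splitPair_self φ P, ← splitPair_self φ P (∑ i ∈ s, e i i), h.splitPair_mul,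
      h.splitPair_mul, mul_assoc ((u : S) : A)]
  have hx : IsMatrixUnits fun i j => splitPair φ P (e i j) (e j i) := by
    intro i j k l
    rw [h.splitPair_mul, he, he]
    by_cases hjk : j = k
    · simp [hjk]
    · simp [hjk, Ne.symm hjk, splitPair]
  have hxs : ∀ t : Finset (Fin n), ∑ i ∈ t, splitPair φ P (e i i) (e i i) = φ (∑ i ∈ t, e i i) :=
    fun t => by simp only [splitPair_self, map_sum]
  let u₁ : Aˣ := Units.map (S.val : S →* A) u
  let v₁ : Aˣ := Units.map (S.val : S →* A) v
  have hrhs : normalizedRank F (((u : S) : A) * (∑ i ∈ s, e i i) * ((v : S) : A)) =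
      normalizedRank F (∑ i ∈ s, e i i) := hA.normalizedRank_units_mul_mul u₁ v₁ _
  have hn' : (n : ℚ) ≠ 0 := by positivity
  have h1 := he.normalizedRank_of_sum hA hsum ⟨0, hn⟩
  have h2 := hx.normalizedRank_of_sum hA
    ((hxs Finset.univ).trans ((congrArg φ hsum).trans h.map_one)) ⟨0, hn⟩
  rw [hφ, hA.normalizedRank_units_mul_mul, hrhs, ← hxs, hx.normalizedRank_sum hA s ⟨0, hn⟩,
    he.normalizedRank_sum hA s ⟨0, hn⟩]
  rw [Fintype.card_fin] at h1 h2
  rw [mul_left_cancel₀ hn' (h2.trans h1.symm)]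

theorem IsLocallyMatrixAlgebra.exists_le_padicValNat {p : Nat.Primes}
    (h : steinitzNumber F A p = ⊤) (k : ℕ) :
    ∃ N ∈ matrixDegrees F A, k ≤ padicValNat p N := by
  by_contra! hlt
  have : steinitzNumber F A p ≤ k := iSup₂_le fun n hn => by exact_mod_cast (hlt n hn).le
  rw [h, top_le_iff] at this
  exact ENat.natCast_ne_top k this

/-- Enlarge the subalgebra of size `m` so that it also contains one whose size has a higher power of
`p`; the quotient of the sizes is then divisible by `p`. -/
theorem IsLocallyMatrixAlgebra.exists_mul_dvd (hA : IsLocallyMatrixAlgebra F A) {p : Nat.Primes}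
    (h : steinitzNumber F A p = ⊤) : ∀ m ∈ matrixDegrees F A,
      ∃ M ∈ matrixDegrees F A, (p : ℕ) * m ∣ M := by
  have : Fact (p : ℕ).Prime := ⟨p.2⟩
  rintro m ⟨S, hm, ⟨g⟩⟩
  obtain ⟨N, ⟨T, hN, ⟨f⟩⟩, hk⟩ := exists_le_padicValNat h (padicValNat p m + 1)
  have := finiteDimensional_of_equiv_matrix g
  have := finiteDimensional_of_equiv_matrix f
  obtain ⟨U, M, e, hM, -, hSU, hTU⟩ := hA.exists_subalgebra_ge Set.finite_empty S T
  obtain ⟨c, rfl⟩ := dvd_of_le g e hm hSU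
  refine ⟨_, ⟨U, hM, ⟨e⟩⟩, ?_⟩
  have hc : c ≠ 0 := by rintro rfl; simp at hM
  have hle : padicValNat p N ≤ padicValNat p (m * c) :=
    (padicValNat_dvd_iff_le hM.ne').1 (pow_padicValNat_dvd.trans (dvd_of_le f e hN hTU))
  rw [padicValNat.mul hm.ne' hc] at hle
  have hpc : (p : ℕ) ∣ c := dvd_of_one_le_padicValNat (by omega)
  rw [mul_comm]
  exact mul_dvd_mul_left m hpc

end

/-! ### The two halves of the theorem -/

theorem corollary2 {F A : Type*} [Field F] [Ring A] [Algebra F A]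
    (hA : IsLocallyMatrixAlgebra F A) :
    (ringChar F ≠ 2 → (steinitzNumber F A).IsLocallyFinite →
      ∀ φ : A →ₗ[F] A, PreservesNormalizedRank φ →
        (φ 1 = 1 → IsAlgHomomorphism φ ∨ IsAlgAntihomomorphism φ) ∧
        ∃ (X Y : Aˣ) (ψ : A →ₗ[F] A), ψ 1 = 1 ∧
          (IsAlgHomomorphism ψ ∨ IsAlgAntihomomorphism ψ) ∧
          ∀ a : A, φ a = X * ψ a * Y) ∧
    (¬ (steinitzNumber F A).IsLocallyFinite → Module.rank F A = Cardinal.aleph0 →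
      ∃ φ : A →ₗ[F] A, PreservesNormalizedRank φ ∧ φ 1 = 1 ∧
        ¬ IsAlgHomomorphism φ ∧ ¬ IsAlgAntihomomorphism φ ∧
        ¬ ∃ (X Y : Aˣ) (ψ : A →ₗ[F] A),
          (IsAlgHomomorphism ψ ∨ IsAlgAntihomomorphism ψ) ∧
          ∀ a : A, φ a = X * ψ a * Y) := by
  constructor
  · intro hchar hst φ hφ
    have h2 : (2 : F) ≠ 0 := Ring.two_ne_zero hchar
    refine ⟨fun h1 => hφ.hom_or_antihom hA h2 hst h1, ?_⟩
    -- `φ 1` has normalized rank 1, so it is a unit and can be moved into `X`; `Y` may be taken to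
    -- be 1.
    obtain ⟨u, hu⟩ := hA.isUnit_of_normalizedRank ((hφ 1).trans hA.normalizedRank_one)
    let ψ : A →ₗ[F] A := LinearMap.mulLeft F (↑u⁻¹ : A) ∘ₗ φ
    have hψ : ∀ a, ψ a = ↑u⁻¹ * φ a := fun a => rfl
    have hψ1 : ψ 1 = 1 := by rw [hψ, ← hu, Units.inv_mul]
    have hψr : PreservesNormalizedRank ψ := fun a => by
      rw [hψ, ← hφ a]
      simpa using hA.normalizedRank_units_mul_mul u⁻¹ 1 (φ a)
    exact ⟨u, 1, ψ, hψ1, hψr.hom_or_antihom hA h2 hst hψ1, fun a => by simp [hψ]⟩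
  · intro hst hdim
    obtain ⟨p, hp⟩ : ∃ p, steinitzNumber F A p = ⊤ := by
      simpa [SteinitzNumber.IsLocallyFinite] using hst
    have hp0 : (p : ℕ) ≠ 0 := p.2.ne_zero
    have hp0' : ((p : ℕ) : ℚ) ≠ 0 := by exact_mod_cast hp0
    have hdiv := hA.exists_mul_dvd hp
    obtain ⟨N, hND, hN⟩ := IsLocallyMatrixAlgebra.exists_le_padicValNat hp 1
    have hpN : (p : ℕ) ∣ N := dvd_of_one_le_padicValNat hN
    obtain ⟨S, hN0, ⟨g⟩⟩ := id hND
    have hN2 : 2 ≤ N := p.2.two_le.trans (Nat.le_of_dvd hN0 hpN)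
    obtain ⟨s, hs⟩ := hpN
    -- A `p × p` system of units for 1, whose diagonal entries have rank `1 / p`.
    obtain ⟨f, hf, hfs⟩ := hA.exists_isMatrixUnits (mul_one (1 : A)) hND (k := p) (s := s)
      (by rw [hA.normalizedRank_one, one_mul, hs]; push_cast; rfl)
    let i : Fin p := ⟨0, p.2.pos⟩
    have hP : normalizedRank F (f i i) = 1 / (p : ℕ) := by
      have := hf.normalizedRank_of_sum hA hfs i
      rw [Fintype.card_fin, hA.normalizedRank_one] at this
      rw [eq_div_iff hp0', mul_comm, this]
    obtain ⟨φ, hφ⟩ := hA.exists_isJordanSplit_top hdim p.2.pos (hf.mul_same i i i) hP hdiv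
    have hnh : ¬ IsAlgHomomorphism φ := by
      intro h
      -- Otherwise `φ` would obey both multiplication rules on the corner of `1 - P`, forcing `P =
      -- 1` against its rank `1 / p`.
      have h0 : 1 - f i i = 0 := eq_zero_of_hom_of_anti g hN2 hφ.map_one
        (fun a _ b _ => by rw [h]) fun a _ b _ => hφ.anti Algebra.mem_top Algebra.mem_top
      rw [← sub_eq_zero.1 h0, hA.normalizedRank_one, eq_div_iff hp0', one_mul] at hP
      exact p.2.ne_one (by exact_mod_cast hP)
    have hna : ¬ IsAlgAntihomomorphism φ := by
      intro h
      have h0 : f i i = 0 := eq_zero_of_hom_of_anti g hN2 hφ.map_one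
        (fun a _ b _ => hφ.hom Algebra.mem_top Algebra.mem_top) fun a _ b _ => by rw [h]
      rw [h0, hA.normalizedRank_zero, eq_div_iff hp0', zero_mul] at hP
      exact zero_ne_one hP
    refine ⟨φ, hφ.preservesNormalizedRank hA, hφ.map_one, hnh, hna, ?_⟩
    rintro ⟨X, Y, ψ, hψ, hφψ⟩
    have h1 : (X : A) * ψ 1 * Y = 1 := by rw [← hφψ, hφ.map_one]
    have hidem : ψ 1 * ψ 1 = ψ 1 := by
      rcases hψ with h | h <;> rw [← h 1 1, mul_one]
    -- An invertible idempotent is 1, so `ψ` is unital, `Y` is the inverse of `X`, and `φ` is a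
    -- conjugate of `ψ`.
    have hu : ψ 1 = (X⁻¹ * Y⁻¹ : Aˣ) := by
      rw [Units.val_mul, Units.eq_inv_mul_iff_mul_eq, ← one_mul (↑Y⁻¹ : A),
        Units.eq_mul_inv_iff_mul_eq, h1]
    have hψ1 : ψ 1 = 1 := by
      have : IsUnit (ψ 1) := hu ▸ Units.isUnit _
      exact this.mul_left_cancel (hidem.trans (mul_one _).symm)
    have hYX : (Y : A) * X = 1 := by
      rw [hψ1, mul_one] at h1
      have : X * Y = 1 := Units.ext h1
      have h3 : Y * X = 1 := by rw [eq_inv_of_mul_eq_one_right this, inv_mul_cancel]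
      exact congrArg Units.val h3
    have hconj : ∀ a b, φ a * φ b = X * (ψ a * ψ b) * Y := fun a b => by
      rw [hφψ, hφψ]
      calc (X : A) * ψ a * Y * (X * ψ b * Y) = X * ψ a * (Y * X) * ψ b * Y := by
            simp only [mul_assoc]
        _ = _ := by rw [hYX, mul_one]; simp only [mul_assoc]
    rcases hψ with h | h
    · exact hnh fun a b => by rw [hconj, hφψ, h]
    · exact hna fun a b => by rw [hconj, hφψ, h]
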